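/- Let $\mathbb{S}^2\subset\mathbb{R}^3$ be the unit sphere, $\sigma_2$ its normalized surface area measure, and $$\Phi:[0,1]^2\to\mathbb{S}^2,\qquad \Phi(y_1,y_2)=\bigl(2\cos(2\pi y_1)\sqrt{y_2-y_2^2},\ 2\sin(2\pi y_1)\sqrt{y_2-y_2^2},\ 1-2y_2\bigr).$$ Let $\mathcal{H}^{3/2}$ be the Hilbert space of functions on $\mathbb{S}^2$ with reproducing kernel $K(\boldsymbol{y},\boldsymbol{z})=\frac83-\|\boldsymbol{y}-\boldsymbol{z}\|$. For points $\boldsymbol{z}_0,\dots,\boldsymbol{z}_{N-1}\in\mathbb{S}^2$ with equal weight rule $Q_N(f)=\frac1N\sum_{k=0}^{N-1}f(\boldsymbol{z}_k)$ let $$e(Q_N,\mathcal{H}^{3/2})=\sup_{f\in\mathcal{H}^{3/2},\ \|f\|\le1}\Bigl|Q_N(f)-\int_{\mathbb{S}^2}f\,\mathrm{d}\sigma_2\Bigr|$$ be the worst-case error, and let $$D_2(Z_N)=\Bigl[\int_{-1}^1\int_{\mathbb{S}^2}\Bigl|\tfrac{|\{k:\boldsymbol{z}_k\in C(\boldsymbol{w},t)\}|}{N}-\sigma_2(C(\boldsymbol{w},t))\Bigr|^2\mathrm{d}\sigma_2(\boldsymbol{w})\,\mathrm{d}t\Bigr]^{1/2},\qquad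 C(\boldsymbol{w},t)=\{\boldsymbol{y}\in\mathbb{S}^2:\langle\boldsymbol{y},\boldsymbol{w}\rangle\le t\},$$ be the spherical cap $L_2$-discrepancy. Let $b\ge2$ and $m\ge1$ be integers. A family of $b^m$ points of $[0,1)^2$ is a $(0,m,2)$-net in base $b$ if for all integers $d_1,d_2\ge0$ with $d_1+d_2=m$ and all integers $0\le a_i<b^{d_i}$ the interval $\prod_{i=1}^2[a_ib^{-d_i},(a_i+1)b^{-d_i})$ contains exactly one of the points. It is a digital $(0,m,2)$-net if moreover it arises from the digital construction: for a commutative ring $R$ with $b$ elements (for instance $\mathbb{Z}/b\mathbb{Z}$, or the field $\mathbb{F}_b$ if $b$ is a prime power), a bijection $\eta:\{0,\dots,b-1\}\to R$ and matrices $C_1,C_2\in R^{m\times m}$, the $i$-th coordinate of the $n$-th point, $0\le n=\sum_{j=0}^{m-1} n_jb^j<b^m$, is $\sum_{k=1}^m\eta^{-1}(y_k)b^{-k}$ with $(y_1,\dots,y_m)^\top=C_i(\eta(n_0),\dots,\eta(n_{m-1}))^\top$. **Corollary.** For every integer $b\ge2$ there is a constant $C>0$ depending only on $b$ such that, for every $m\ge1$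 and every digital $(0,m,2)$-net $P_N$ in base $b$ with $N=b^m$ points, the lifted points $Z_N=\Phi(P_N)$ and their equal weight rule $Q_N$ satisfy $$e^2(Q_N,\mathcal{H}^{3/2})\le C\,N^{-1}\log N .$$ Equivalently, by Stolarsky's invariance principle $e^2(Q_N,\mathcal{H}^{3/2})=4\,D_2(Z_N)^2$, which holds for these points, their spherical cap $L_2$-discrepancy satisfies (with a constant $C$ of the same kind) $D_2(Z_N)\le C\,N^{-1/2}(\log N)^{1/2}$. In particular both quantities are $\mathcal{O}(N^{-1}\log N)$ and $\mathcal{O}(N^{-1/2}(\log N)^{1/2})$, respectively, as $N=b^m\to\infty$ with $b$ fixed. -/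

import Mathlib

open scoped unitInterval

noncomputable section

namespace SphereNets

/-! ### Digital `(0,m,2)`-nets in base `b` -/

/-- The vector of base `b` digits `(n_0, …, n_{m-1})` of `n = n_0 + n_1 b + ⋯`, read as elements of
the ring `R` of order `b` through the bijection `η` between the digits `{0, …, b-1}` and `R`. -/
def digitVector {b : ℕ} (hb : 2 ≤ b) (m : ℕ) {R : Type*} (η : Fin b ≃ R) (n : ℕ) : Fin m → R :=
  fun j => η ⟨n / b ^ (j : ℕ) % b, Nat.mod_lt _ (by omega)⟩

/-- The real number `y_1 / b + y_2 / b ^ 2 + ⋯ + y_m / b ^ m`. -/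
def radix {b m : ℕ} (y : Fin m → Fin b) : ℝ :=
  ∑ i : Fin m, ((y i : ℕ) : ℝ) / (b : ℝ) ^ ((i : ℕ) + 1)

theorem radix_mem {b m : ℕ} (hb : 2 ≤ b) (y : Fin m → Fin b) : radix y ∈ Set.Icc (0 : ℝ) 1 := by
  have hb0 : (0 : ℝ) < b := by exact_mod_cast (by omega : 0 < b)
  refine ⟨Finset.sum_nonneg fun i _ => by positivity, ?_⟩
  have key : ∀ k : ℕ, ∑ i ∈ Finset.range k, ((b : ℝ) - 1) / (b : ℝ) ^ (i + 1)
      = 1 - 1 / (b : ℝ) ^ k := by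
    intro k
    induction k with
    | zero => simp
    | succ k ih => rw [Finset.sum_range_succ, ih]; field_simp; ring
  calc radix y ≤ ∑ i : Fin m, ((b : ℝ) - 1) / (b : ℝ) ^ ((i : ℕ) + 1) := by
        refine Finset.sum_le_sum fun i _ => ?_
        have h : ((y i : ℕ) : ℝ) + 1 ≤ b := by exact_mod_cast (y i).isLt
        gcongr
        linarith
    _ = 1 - 1 / (b : ℝ) ^ m := by
        rw [Fin.sum_univ_eq_sum_range (fun i => ((b : ℝ) - 1) / (b : ℝ) ^ (i + 1)), key]
    _ ≤ 1 := by
        have : (0 : ℝ) ≤ 1 / (b : ℝ) ^ m := by positivity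
        linarith

/-- One coordinate of the `n`-th point of the digital net with generating matrix `A`: the digit
vector of `n` is multiplied by `A`, and the result is read as digits after the radix point. -/
def digitalCoord {b : ℕ} (hb : 2 ≤ b) {m : ℕ} {R : Type*} [CommRing R] (η : Fin b ≃ R)
    (A : Matrix (Fin m) (Fin m) R) (n : ℕ) : I :=
  ⟨radix fun i => η.symm ((A.mulVec (digitVector hb m η n)) i), radix_mem hb _⟩

/-- The point set of `b ^ m` points produced by the digital construction scheme over a commutative
ring `R` of order `b` (for `b` prime: `R = ℤ/bℤ` with its usual digits; for a prime power: the field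
of order `b`) with generating matrices `C₁`, `C₂`. -/
def digitalPoints {b : ℕ} (hb : 2 ≤ b) {m : ℕ} {R : Type*} [CommRing R] (η : Fin b ≃ R)
    (C₁ C₂ : Matrix (Fin m) (Fin m) R) : Fin (b ^ m) → I × I :=
  fun n => (digitalCoord hb η C₁ n, digitalCoord hb η C₂ n)

/-- `(0,m,2)`-nets in base `b`: `b ^ m` points of `[0,1)²` such that each elementary interval of
area `b ^ (-m)` contains exactly one of them. -/
def IsNet (b m : ℕ) (P : Fin (b ^ m) → I × I) : Prop :=
  (∀ n, ((P n).1 : ℝ) < 1 ∧ ((P n).2 : ℝ) < 1) ∧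
  ∀ d₁ d₂ : ℕ, d₁ + d₂ = m → ∀ a₁ < b ^ d₁, ∀ a₂ < b ^ d₂,
    ∃! n : Fin (b ^ m),
      ((P n).1 : ℝ) ∈ Set.Ico ((a₁ : ℝ) / (b : ℝ) ^ d₁) (((a₁ : ℝ) + 1) / (b : ℝ) ^ d₁) ∧
      ((P n).2 : ℝ) ∈ Set.Ico ((a₂ : ℝ) / (b : ℝ) ^ d₂) (((a₂ : ℝ) + 1) / (b : ℝ) ^ d₂)

/-! ### The sphere, its normalized surface measure, and the lifting map -/

/-- The unit sphere in `ℝ³`. -/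
abbrev S2 : Type := Metric.sphere (0 : EuclideanSpace ℝ (Fin 3)) 1

/-- The normalized surface area measure on the unit sphere. -/
def sigma2 : MeasureTheory.Measure S2 :=
  ((MeasureTheory.volume : MeasureTheory.Measure (EuclideanSpace ℝ (Fin 3))).toSphere Set.univ)⁻¹ •
    (MeasureTheory.volume : MeasureTheory.Measure (EuclideanSpace ℝ (Fin 3))).toSphere

/-- The area-preserving map
`Φ(y₁, y₂) = (2 cos(2πy₁) √(y₂ - y₂²), 2 sin(2πy₁) √(y₂ - y₂²), 1 - 2y₂)`. -/
def Phi (p : I × I) : S2 :=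
  ⟨!₂[2 * Real.cos (2 * Real.pi * p.1) * √((p.2 : ℝ) - (p.2 : ℝ) ^ 2),
      2 * Real.sin (2 * Real.pi * p.1) * √((p.2 : ℝ) - (p.2 : ℝ) ^ 2),
      1 - 2 * (p.2 : ℝ)], by
    have h0 : (0 : ℝ) ≤ p.2 := p.2.2.1
    have h1 : (p.2 : ℝ) ≤ 1 := p.2.2.2
    have hs := Real.sq_sqrt (show (0 : ℝ) ≤ (p.2 : ℝ) - (p.2 : ℝ) ^ 2 by nlinarith)
    have hc := Real.sin_sq_add_cos_sq (2 * Real.pi * p.1)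
    rw [mem_sphere_zero_iff_norm, EuclideanSpace.norm_eq, Real.sqrt_eq_one, Fin.sum_univ_three]
    simp only [Real.norm_eq_abs, sq_abs, Matrix.cons_val_zero,
      Matrix.cons_val_one, Matrix.cons_val]
    set s := Real.sin (2 * Real.pi * p.1)
    set c := Real.cos (2 * Real.pi * p.1)
    set r := √((p.2 : ℝ) - (p.2 : ℝ) ^ 2)
    calc (2 * c * r) ^ 2 + (2 * s * r) ^ 2 + (1 - 2 * (p.2 : ℝ)) ^ 2
        = 4 * r ^ 2 * (s ^ 2 + c ^ 2) + (1 - 2 * (p.2 : ℝ)) ^ 2 := by ring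
      _ = 1 := by rw [hs, hc]; ring⟩

/-! ### The Hilbert space with reproducing kernel `8/3 - ‖y - z‖` -/

/-- The kernel `K(y, z) = 8/3 - ‖y - z‖` on the sphere; its values act on `ℝ` by multiplication. -/
def distKernel : Matrix S2 S2 (ℝ →L[ℝ] ℝ) :=
  Matrix.of fun y z => (8 / 3 - ‖(y : EuclideanSpace ℝ (Fin 3)) - z‖) • ContinuousLinearMap.id ℝ ℝ

/-- The signed indicator of the interval between `0` and `s`. -/
def stepFun (s u : ℝ) : ℝ := (Set.Ico 0 s).indicator 1 u - (Set.Ico s 0).indicator 1 u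

theorem stepFun_mul (s t u : ℝ) : stepFun s u * stepFun t u =
    (Set.Ico 0 (min s t)).indicator 1 u + (Set.Ico (max s t) 0).indicator 1 u := by
  simp only [stepFun, Set.indicator_apply, Set.mem_Ico, lt_min_iff, max_le_iff, Pi.one_apply]
  split_ifs <;> grind

theorem integrable_indicator_Ico (a b : ℝ) :
    MeasureTheory.Integrable ((Set.Ico a b).indicator (1 : ℝ → ℝ)) :=
  (MeasureTheory.integrable_indicator_iff measurableSet_Ico).2
    (MeasureTheory.integrableOn_const (C := (1 : ℝ)) (by simp) (by simp))

theorem stepFun_integrable_mul (s t : ℝ) :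
    MeasureTheory.Integrable (fun u => stepFun s u * stepFun t u) := by
  simp only [stepFun_mul]
  exact (integrable_indicator_Ico _ _).add (integrable_indicator_Ico _ _)

theorem stepFun_integral (s t : ℝ) :
    ∫ u, stepFun s u * stepFun t u = (|s| + |t| - |s - t|) / 2 := by
  simp only [stepFun_mul]
  rw [MeasureTheory.integral_add (integrable_indicator_Ico _ _) (integrable_indicator_Ico _ _),
    MeasureTheory.integral_indicator_one measurableSet_Ico,
    MeasureTheory.integral_indicator_one measurableSet_Ico, Real.volume_real_Ico,
    Real.volume_real_Ico]
  rcases le_total 0 s with hs | hs <;> rcases le_total 0 t with ht | ht <;>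
    rcases le_total s t with hst | hst <;>
    simp only [abs_of_nonneg, abs_of_nonpos, sub_nonneg, sub_nonpos, hs, ht, hst, min_eq_left,
      min_eq_right, max_eq_left, max_eq_right, sub_zero, zero_sub, neg_nonneg, neg_nonpos] <;>
      linarith

theorem abs_kernel_nonneg {ι : Type*} (S : Finset ι) (c s : ι → ℝ) :
    0 ≤ ∑ i ∈ S, ∑ j ∈ S, c i * c j * (|s i| + |s j| - |s i - s j|) := by
  have h : ∑ i ∈ S, ∑ j ∈ S, c i * c j * (|s i| + |s j| - |s i - s j|)
      = 2 * ∫ u, (∑ i ∈ S, c i * stepFun (s i) u) ^ 2 := by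
    have e : ∀ u, (∑ i ∈ S, c i * stepFun (s i) u) ^ 2
        = ∑ i ∈ S, ∑ j ∈ S, c i * c j * (stepFun (s i) u * stepFun (s j) u) := by
      intro u
      rw [sq, Finset.sum_mul_sum]
      exact Finset.sum_congr rfl fun i _ => Finset.sum_congr rfl fun j _ => by ring
    simp only [e]
    rw [MeasureTheory.integral_finsetSum _ fun i _ => MeasureTheory.integrable_finsetSum _
      fun j _ => (stepFun_integrable_mul _ _).const_mul _, Finset.mul_sum]
    refine Finset.sum_congr rfl fun i _ => ?_
    rw [MeasureTheory.integral_finsetSum _ fun j _ => (stepFun_integrable_mul _ _).const_mul _,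
      Finset.mul_sum]
    refine Finset.sum_congr rfl fun j _ => ?_
    rw [MeasureTheory.integral_const_mul, stepFun_integral]
    ring
  rw [h]
  exact mul_nonneg (by norm_num) (MeasureTheory.integral_nonneg fun u => sq_nonneg _)

theorem integrableOn_abs_inner (v : EuclideanSpace ℝ (Fin 3)) :
    MeasureTheory.IntegrableOn (fun z => |inner ℝ v z|) (Metric.ball 0 1) := by
  have hc : Continuous fun z : EuclideanSpace ℝ (Fin 3) => |inner ℝ v z| := by fun_prop
  exact (hc.continuousOn.integrableOn_compact (isCompact_closedBall 0 1)).mono_set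
    Metric.ball_subset_closedBall

theorem integral_abs_inner_eq {v w : EuclideanSpace ℝ (Fin 3)} (h : ‖v‖ = ‖w‖) :
    ∫ z in Metric.ball (0 : EuclideanSpace ℝ (Fin 3)) 1, |inner ℝ v z| =
      ∫ z in Metric.ball (0 : EuclideanSpace ℝ (Fin 3)) 1, |inner ℝ w z| := by
  set L := (Submodule.span ℝ {v - w})ᗮ.reflection
  have hL : L v = w := Submodule.reflection_sub h
  have hmp : MeasureTheory.MeasurePreserving L := L.measurePreserving
  have hpre : L ⁻¹' Metric.ball 0 1 = Metric.ball 0 1 := by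
    ext z; simp
  have := hmp.setIntegral_preimage_emb L.toHomeomorph.measurableEmbedding
    (fun z => |inner ℝ w z|) (Metric.ball 0 1)
  rw [hpre] at this
  rw [← this]
  refine MeasureTheory.integral_congr_ae (Filter.Eventually.of_forall fun z => ?_)
  simp only [← hL, LinearIsometryEquiv.inner_map_map]

theorem exists_norm_eq_integral : ∃ k : ℝ, 0 < k ∧ ∀ v : EuclideanSpace ℝ (Fin 3),
    ∫ z in Metric.ball (0 : EuclideanSpace ℝ (Fin 3)) 1, |inner ℝ v z| = k * ‖v‖ := by
  set e : EuclideanSpace ℝ (Fin 3) := EuclideanSpace.single 0 1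
  have he : ‖e‖ = 1 := by simp [e]
  refine ⟨∫ z in Metric.ball (0 : EuclideanSpace ℝ (Fin 3)) 1, |inner ℝ e z|, ?_, fun v => ?_⟩
  · have hc : Continuous fun z : EuclideanSpace ℝ (Fin 3) => |inner ℝ e z| := by fun_prop
    rw [MeasureTheory.setIntegral_pos_iff_support_of_nonneg_ae
      (Filter.Eventually.of_forall fun z => abs_nonneg _) (integrableOn_abs_inner e)]
    refine (hc.isOpen_support.inter Metric.isOpen_ball).measure_pos _ ⟨(1 / 2 : ℝ) • e, ?_, ?_⟩
    · simp [inner_smul_right, he]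
    · simp only [mem_ball_zero_iff, norm_smul, he]; norm_num
  · have h : ‖v‖ = ‖‖v‖ • e‖ := by simp [norm_smul, he]
    rw [integral_abs_inner_eq h, mul_comm, ← MeasureTheory.integral_const_mul]
    simp [inner_smul_left, abs_mul]

theorem norm_kernel_nonneg {ι : Type*} (S : Finset ι) (c : ι → ℝ)
    (x : ι → EuclideanSpace ℝ (Fin 3)) :
    0 ≤ ∑ i ∈ S, ∑ j ∈ S, c i * c j * (‖x i‖ + ‖x j‖ - ‖x i - x j‖) := by
  obtain ⟨k, hk, hint⟩ := exists_norm_eq_integral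
  have hi := integrableOn_abs_inner
  have hij : ∀ i j, MeasureTheory.IntegrableOn (fun z => c i * c j *
      (|inner ℝ (x i) z| + |inner ℝ (x j) z| - |inner ℝ (x i - x j) z|)) (Metric.ball 0 1) :=
    fun i j => (((hi _).add (hi _)).sub (hi _)).const_mul _
  have h : k * ∑ i ∈ S, ∑ j ∈ S, c i * c j * (‖x i‖ + ‖x j‖ - ‖x i - x j‖)
      = ∫ z in Metric.ball (0 : EuclideanSpace ℝ (Fin 3)) 1, ∑ i ∈ S, ∑ j ∈ S, c i * c j *
        (|inner ℝ (x i) z| + |inner ℝ (x j) z| - |inner ℝ (x i - x j) z|) := by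
    rw [MeasureTheory.integral_finsetSum _ fun i _ => MeasureTheory.integrable_finsetSum _
      fun j _ => hij i j, Finset.mul_sum]
    refine Finset.sum_congr rfl fun i _ => ?_
    rw [MeasureTheory.integral_finsetSum _ fun j _ => hij i j, Finset.mul_sum]
    refine Finset.sum_congr rfl fun j _ => ?_
    have e1 := MeasureTheory.integral_sub ((hi (x i)).add (hi (x j))) (hi (x i - x j))
    have e2 := MeasureTheory.integral_add (hi (x i)) (hi (x j))
    simp only [Pi.add_apply] at e1
    rw [MeasureTheory.integral_const_mul, e1, e2, hint, hint, hint]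
    ring
  refine nonneg_of_mul_nonneg_right (h ▸ MeasureTheory.integral_nonneg fun z => ?_) hk
  have := abs_kernel_nonneg S c fun i => inner ℝ (x i) z
  simpa only [inner_sub_left, Pi.zero_apply] using this

theorem distKernel_posSemidef : distKernel.PosSemidef := by
  have tfae := (RKHS.posSemidef_tfae (K := distKernel)).out 0 2
  refine tfae.2 ⟨?_, fun vv => ?_⟩
  · have hst : star (ContinuousLinearMap.id ℝ ℝ) = ContinuousLinearMap.id ℝ ℝ := star_one _
    ext y z
    simp [distKernel, Matrix.conjTranspose_apply, norm_sub_rev, hst]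
  · have h1 := norm_kernel_nonneg vv.support vv fun p : S2 => (p : EuclideanSpace ℝ (Fin 3))
    have h2 : (0 : ℝ) ≤ 2 / 3 * (∑ p ∈ vv.support, vv p) ^ 2 := by positivity
    have h3 := add_nonneg h1 h2
    rw [sq, Finset.sum_mul_sum, Finset.mul_sum, ← Finset.sum_add_distrib] at h3
    simp only [Finsupp.sum, RCLike.re_to_real]
    refine h3.trans_eq (Finset.sum_congr rfl fun p _ => ?_)
    rw [Finset.mul_sum, ← Finset.sum_add_distrib]
    refine Finset.sum_congr rfl fun q _ => ?_
    have hp : ‖(p : EuclideanSpace ℝ (Fin 3))‖ = 1 := norm_eq_of_mem_sphere p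
    have hq : ‖(q : EuclideanSpace ℝ (Fin 3))‖ = 1 := norm_eq_of_mem_sphere q
    simp [distKernel, hp, hq, norm_sub_rev (q : EuclideanSpace ℝ (Fin 3))]
    ring

instance : Fact distKernel.PosSemidef := ⟨distKernel_posSemidef⟩

/-- The Hilbert space `H^{3/2}` of functions on the sphere with reproducing kernel
`8/3 - ‖y - z‖`. -/
abbrev H32 : Type := RKHS.OfKernel distKernel

/-! ### Worst-case error and spherical cap discrepancy -/

/-- The equal weight quadrature rule `Q_N(f) = (1/N) ∑ f(z_k)`. -/
def quadrature {N : ℕ} (z : Fin N → S2) (f : S2 → ℝ) : ℝ := (1 / (N : ℝ)) * ∑ k, f (z k)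

/-- The worst-case error `e(Q_N, H^{3/2})` over the unit ball of `H^{3/2}`. -/
def worstCaseError {N : ℕ} (z : Fin N → S2) : ℝ :=
  sSup {r : ℝ | ∃ f : H32, ‖f‖ ≤ 1 ∧ r = |quadrature z f - ∫ w, f w ∂sigma2|}

/-- The spherical cap `C(w, t) = {y : ⟨y, w⟩ ≤ t}`. -/
def cap (w : S2) (t : ℝ) : Set S2 :=
  {y | inner ℝ (y : EuclideanSpace ℝ (Fin 3)) (w : EuclideanSpace ℝ (Fin 3)) ≤ t}

/-- The spherical cap `L₂`-discrepancy of the points `z_0, …, z_{N-1}`. -/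
def capL2Discrepancy {N : ℕ} (z : Fin N → S2) : ℝ :=
  √(∫ t in (-1 : ℝ)..1, ∫ w, |(Nat.card {k // z k ∈ cap w t} : ℝ) / N
      - sigma2.real (cap w t)| ^ 2 ∂sigma2)

end SphereNets

end

noncomputable section

namespace SphereNets

open MeasureTheory Set
open scoped Pointwise

/-! ### The lifting map preserves the normalized measure -/

theorem measurable_toLp_three {α : Type*} [MeasurableSpace α] {f g h : α → ℝ}
    (hf : Measurable f) (hg : Measurable g) (hh : Measurable h) :
    Measurable fun a => (!₂[f a, g a, h a] : EuclideanSpace ℝ (Fin 3)) := by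
  refine (MeasurableEquiv.toLp 2 (Fin 3 → ℝ)).measurable.comp (measurable_pi_iff.2 fun i => ?_)
  fin_cases i <;> simpa

theorem lintegral_eq_lintegral_prod (F : EuclideanSpace ℝ (Fin 3) → ENNReal) (hF : Measurable F) :
    ∫⁻ x, F x = ∫⁻ z : ℝ, ∫⁻ p : ℝ × ℝ, F !₂[p.1, p.2, z] := by
  have hm : Measurable fun q : ℝ × ℝ × ℝ => F !₂[q.2.1, q.2.2, q.1] :=
    hF.comp (measurable_toLp_three (by fun_prop) (by fun_prop) (by fun_prop))
  have h1 := EuclideanSpace.volume_preserving_symm_measurableEquiv_toLp (Fin 3)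
  have h2 := volume_preserving_piFinSuccAbove (fun _ : Fin 3 => ℝ) 2
  have h3 : MeasurePreserving (Prod.map (id : ℝ → ℝ) (MeasurableEquiv.finTwoArrow (α := ℝ)))
      volume volume :=
    (MeasurePreserving.id volume).prod (volume_preserving_finTwoArrow ℝ)
  have h := (h3.comp (h2.comp h1)).lintegral_comp hm
  rw [Measure.volume_eq_prod, lintegral_prod _ hm.aemeasurable] at h
  rw [← h]
  refine lintegral_congr fun x => congrArg F ?_
  ext i
  fin_cases i <;> rfl

theorem lintegral_polar_neg (f : ℝ × ℝ → ENNReal) (hf : Measurable f) :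
    ∫⁻ p, f p = ∫⁻ ρ in Ioi (0 : ℝ), ∫⁻ θ in Ioo (-Real.pi) Real.pi,
      ENNReal.ofReal ρ * f (-(ρ * Real.cos θ), -(ρ * Real.sin θ)) := by
  have hm : Measurable fun p : ℝ × ℝ =>
      ENNReal.ofReal p.1 * f (-(p.1 * Real.cos p.2), -(p.1 * Real.sin p.2)) := by
    refine Measurable.mul (by fun_prop) (hf.comp (by fun_prop))
  rw [← lintegral_neg_eq_self, ← lintegral_comp_polarCoord_symm, polarCoord_target,
    Measure.volume_eq_prod, ← Measure.prod_restrict]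
  simp only [polarCoord_symm_apply, Prod.neg_mk, smul_eq_mul]
  rw [lintegral_prod _ hm.aemeasurable]

theorem lintegral_halfplane_polar (f : ℝ × ℝ → ENNReal) (hf : Measurable f) :
    ∫⁻ z : ℝ, ∫⁻ ρ in Ioi (0 : ℝ), f (z, ρ) = ∫⁻ r in Ioi (0 : ℝ), ∫⁻ ψ in Ioo 0 Real.pi,
      ENNReal.ofReal r * f (r * Real.cos ψ, r * Real.sin ψ) := by
  set g : ℝ × ℝ → ENNReal := (univ ×ˢ Ioi (0 : ℝ)).indicator f
  have hg : Measurable g := hf.indicator (MeasurableSet.univ.prod measurableSet_Ioi)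
  have h1 : ∫⁻ z : ℝ, ∫⁻ ρ in Ioi (0 : ℝ), f (z, ρ) = ∫⁻ p, g p := by
    rw [Measure.volume_eq_prod, lintegral_prod _ hg.aemeasurable]
    refine lintegral_congr fun z => ?_
    rw [← lintegral_indicator measurableSet_Ioi]
    refine lintegral_congr fun ρ => ?_
    simp [g, indicator_apply]
  have hm : Measurable fun p : ℝ × ℝ =>
      ENNReal.ofReal p.1 * g (p.1 * Real.cos p.2, p.1 * Real.sin p.2) := by
    refine Measurable.mul (by fun_prop) (hg.comp (by fun_prop))
  rw [h1, ← lintegral_comp_polarCoord_symm, polarCoord_target,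
    Measure.volume_eq_prod, ← Measure.prod_restrict]
  simp only [polarCoord_symm_apply, smul_eq_mul]
  rw [lintegral_prod _ hm.aemeasurable]
  refine setLIntegral_congr_fun measurableSet_Ioi fun r hr => ?_
  rw [← lintegral_indicator measurableSet_Ioo, ← lintegral_indicator measurableSet_Ioo]
  refine lintegral_congr fun ψ => ?_
  have hr' : (0 : ℝ) < r := hr
  by_cases hψ : ψ ∈ Ioo 0 Real.pi
  · have hs := Real.sin_pos_of_mem_Ioo hψ
    have : ψ ∈ Ioo (-Real.pi) Real.pi := ⟨by linarith [hψ.1, Real.pi_pos], hψ.2⟩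
    simp [g, hψ, this, indicator_apply, hr', hs]
  · by_cases h : ψ ∈ Ioo (-Real.pi) Real.pi
    · have hs : Real.sin ψ ≤ 0 := by
        refine Real.sin_nonpos_of_nonpos_of_neg_pi_le ?_ h.1.le
        by_contra hc
        exact hψ ⟨not_le.1 hc, h.2⟩
      have : ¬ 0 < r * Real.sin ψ := not_lt.2 (mul_nonpos_of_nonneg_of_nonpos hr'.le hs)
      simp [g, indicator_apply, this, hψ]
    · simp [hψ, h]

theorem lintegral_half_angle (g : ℝ → ENNReal) :
    ∫⁻ ψ in Ioo 0 Real.pi, ENNReal.ofReal (Real.sin ψ / 2) * g ((1 - Real.cos ψ) / 2) =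
      ∫⁻ y in Ioo (0 : ℝ) 1, g y := by
  have hd : ∀ ψ ∈ Ioo 0 Real.pi, HasDerivWithinAt (fun ψ => (1 - Real.cos ψ) / 2)
      (Real.sin ψ / 2) (Ioo 0 Real.pi) ψ := fun ψ _ => by
    simpa using (((Real.hasDerivAt_cos ψ).const_sub 1).div_const 2).hasDerivWithinAt
  have hi : InjOn (fun ψ => (1 - Real.cos ψ) / 2) (Ioo 0 Real.pi) := fun x hx y hy h =>
    Real.injOn_cos (Ioo_subset_Icc_self hx) (Ioo_subset_Icc_self hy) (by simp only at h; linarith)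
  have him : (fun ψ => (1 - Real.cos ψ) / 2) '' Ioo 0 Real.pi = Ioo 0 1 := by
    ext y
    constructor
    · rintro ⟨ψ, hψ, rfl⟩
      have h1 := Real.strictAntiOn_cos (left_mem_Icc.2 Real.pi_pos.le)
        (Ioo_subset_Icc_self hψ) hψ.1
      have h2 := Real.strictAntiOn_cos (Ioo_subset_Icc_self hψ)
        (right_mem_Icc.2 Real.pi_pos.le) hψ.2
      rw [Real.cos_zero] at h1
      rw [Real.cos_pi] at h2
      constructor <;> simp only <;> linarith
    · intro hy
      refine ⟨Real.arccos (1 - 2 * y), ⟨Real.arccos_pos.2 (by linarith [hy.1]), ?_⟩, ?_⟩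
      · exact lt_of_le_of_ne (Real.arccos_le_pi _) fun h => by
          rw [Real.arccos_eq_pi] at h; linarith [hy.2]
      · simp only
        rw [Real.cos_arccos (by linarith [hy.2]) (by linarith [hy.1])]
        ring
  rw [← him, lintegral_image_eq_lintegral_abs_deriv_mul measurableSet_Ioo hd hi]
  refine setLIntegral_congr_fun measurableSet_Ioo fun ψ hψ => ?_
  rw [abs_of_nonneg (by linarith [Real.sin_pos_of_mem_Ioo hψ])]

theorem lintegral_angle (g : ℝ → ENNReal) :
    ∫⁻ θ in Ioo (-Real.pi) Real.pi, g θ =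
      ENNReal.ofReal (2 * Real.pi) * ∫⁻ y in Ioo (0 : ℝ) 1, g (2 * Real.pi * y - Real.pi) := by
  have hp := Real.pi_pos
  have hd : ∀ y ∈ Ioo (0 : ℝ) 1, HasDerivWithinAt (fun y => 2 * Real.pi * y - Real.pi)
      (2 * Real.pi) (Ioo 0 1) y := fun y _ => by
    simpa using (((hasDerivAt_id y).const_mul (2 * Real.pi)).sub_const Real.pi).hasDerivWithinAt
  have hi : InjOn (fun y => 2 * Real.pi * y - Real.pi) (Ioo (0 : ℝ) 1) := fun x _ y _ h => by
    have : 2 * Real.pi * x = 2 * Real.pi * y := by simp only at h; linarith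
    exact mul_left_cancel₀ (by positivity) this
  have him : (fun y => 2 * Real.pi * y - Real.pi) '' Ioo (0 : ℝ) 1 = Ioo (-Real.pi) Real.pi := by
    ext θ
    constructor
    · rintro ⟨y, hy, rfl⟩
      constructor <;> simp only <;> nlinarith [hy.1, hy.2]
    · intro h
      refine ⟨(θ + Real.pi) / (2 * Real.pi), ⟨?_, ?_⟩, ?_⟩
      · exact div_pos (by linarith [h.1]) (by positivity)
      · rw [div_lt_one (by positivity)]; linarith [h.2]
      · field_simp; ring
  rw [← him, lintegral_image_eq_lintegral_abs_deriv_mul measurableSet_Ioo hd hi,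
    abs_of_pos (by positivity), lintegral_const_mul' _ _ ENNReal.ofReal_ne_top]

/-- The formula for `Phi` on pairs of real numbers. -/
def sphereParam (x y : ℝ) : EuclideanSpace ℝ (Fin 3) :=
  !₂[2 * Real.cos (2 * Real.pi * x) * √(y - y ^ 2),
    2 * Real.sin (2 * Real.pi * x) * √(y - y ^ 2), 1 - 2 * y]

theorem coe_Phi (p : I × I) : (Phi p : EuclideanSpace ℝ (Fin 3)) = sphereParam p.1 p.2 := rfl

theorem lintegral_sphereParam (F : EuclideanSpace ℝ (Fin 3) → ENNReal) (hF : Measurable F) :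
    ∫⁻ x, F x = ENNReal.ofReal (2 * Real.pi) * ∫⁻ x in Ioo (0 : ℝ) 1, ∫⁻ r in Ioi (0 : ℝ),
      ∫⁻ y in Ioo (0 : ℝ) 1, ENNReal.ofReal (2 * r ^ 2) * F (r • sphereParam x y) := by
  have hF3 : Measurable fun q : ℝ × ℝ × ℝ => F !₂[q.1, q.2.1, q.2.2] :=
    hF.comp (measurable_toLp_three (by fun_prop) (by fun_prop) (by fun_prop))
  rw [lintegral_eq_lintegral_prod F hF]
  have e1 : ∀ z : ℝ, ∫⁻ p : ℝ × ℝ, F !₂[p.1, p.2, z] = ∫⁻ θ in Ioo (-Real.pi) Real.pi,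
      ∫⁻ ρ in Ioi (0 : ℝ), ENNReal.ofReal ρ * F !₂[-(ρ * Real.cos θ), -(ρ * Real.sin θ), z] := by
    intro z
    rw [lintegral_polar_neg (fun p => F !₂[p.1, p.2, z])
      (hF3.comp (f := fun p : ℝ × ℝ => (p.1, p.2, z)) (by fun_prop))]
    refine lintegral_lintegral_swap (Measurable.aemeasurable ?_)
    exact Measurable.mul (by fun_prop)
      (hF3.comp (f := fun p : ℝ × ℝ => (-(p.1 * Real.cos p.2), -(p.1 * Real.sin p.2), z))
        (by fun_prop))
  simp only [e1]
  rw [lintegral_lintegral_swap, lintegral_angle]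
  · congr 1
    refine lintegral_congr fun x => ?_
    rw [lintegral_halfplane_polar (fun p => ENNReal.ofReal p.2 *
      F !₂[-(p.2 * Real.cos (2 * Real.pi * x - Real.pi)),
        -(p.2 * Real.sin (2 * Real.pi * x - Real.pi)), p.1])]
    · refine setLIntegral_congr_fun measurableSet_Ioi fun r hr => ?_
      have hr' : (0 : ℝ) < r := hr
      simp only
      rw [← lintegral_half_angle]
      refine setLIntegral_congr_fun measurableSet_Ioo fun ψ hψ => ?_
      have hs := Real.sin_pos_of_mem_Ioo hψ
      have hsq : √((1 - Real.cos ψ) / 2 - ((1 - Real.cos ψ) / 2) ^ 2) = Real.sin ψ / 2 := by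
        rw [show (1 - Real.cos ψ) / 2 - ((1 - Real.cos ψ) / 2) ^ 2 = (Real.sin ψ / 2) ^ 2 by
          nlinarith [Real.sin_sq_add_cos_sq ψ]]
        exact Real.sqrt_sq (by linarith)
      simp only [sphereParam, hsq, Real.cos_sub_pi, Real.sin_sub_pi]
      rw [← mul_assoc, ← mul_assoc, ← ENNReal.ofReal_mul hr'.le,
        ← ENNReal.ofReal_mul (by positivity)]
      congr 2
      · ring
      · ext i
        fin_cases i
        · simp; ring
        · simp; ring
        · simp only [PiLp.smul_apply, smul_eq_mul, Fin.reduceFinMk, Matrix.cons_val]; ring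
    · exact Measurable.mul (by fun_prop)
        (hF3.comp (f := fun p : ℝ × ℝ => (-(p.2 * Real.cos (2 * Real.pi * x - Real.pi)),
          -(p.2 * Real.sin (2 * Real.pi * x - Real.pi)), p.1)) (by fun_prop))
  · refine Measurable.aemeasurable ?_
    have hm : Measurable fun q : (ℝ × ℝ) × ℝ => ENNReal.ofReal q.2 *
        F !₂[-(q.2 * Real.cos q.1.2), -(q.2 * Real.sin q.1.2), q.1.1] :=
      Measurable.mul (by fun_prop)
        (hF3.comp (f := fun q : (ℝ × ℝ) × ℝ =>
          (-(q.2 * Real.cos q.1.2), -(q.2 * Real.sin q.1.2), q.1.1)) (by fun_prop))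
    exact hm.lintegral_prod_right' (ν := volume.restrict (Ioi 0))

theorem continuous_sphereParam : Continuous fun p : ℝ × ℝ => sphereParam p.1 p.2 := by
  unfold sphereParam
  refine (PiLp.continuous_toLp 2 _).comp (continuous_pi fun i => ?_)
  fin_cases i <;> simp <;> fun_prop

theorem continuous_Phi : Continuous Phi :=
  Continuous.subtype_mk (continuous_sphereParam.comp
    (f := fun p : I × I => ((p.1 : ℝ), (p.2 : ℝ))) (by fun_prop)) _

theorem norm_sphereParam (x : ℝ) {y : ℝ} (hy : y ∈ Icc (0 : ℝ) 1) : ‖sphereParam x y‖ = 1 := by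
  have hs := Real.sq_sqrt (show (0 : ℝ) ≤ y - y ^ 2 by nlinarith [hy.1, hy.2])
  have hc := Real.sin_sq_add_cos_sq (2 * Real.pi * x)
  rw [EuclideanSpace.norm_eq, Real.sqrt_eq_one, Fin.sum_univ_three]
  simp only [sphereParam, Real.norm_eq_abs, sq_abs, Matrix.cons_val_zero,
    Matrix.cons_val_one, Matrix.cons_val]
  set s := Real.sin (2 * Real.pi * x)
  set c := Real.cos (2 * Real.pi * x)
  set r := √(y - y ^ 2)
  calc (2 * c * r) ^ 2 + (2 * s * r) ^ 2 + (1 - 2 * y) ^ 2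
      = 4 * r ^ 2 * (s ^ 2 + c ^ 2) + (1 - 2 * y) ^ 2 := by ring
    _ = 1 := by rw [hs, hc]; ring

theorem cone_eq (A : Set (EuclideanSpace ℝ (Fin 3))) (hA : A ⊆ Metric.sphere 0 1) :
    Ioo (0 : ℝ) 1 • A = {x | ‖x‖ ∈ Ioo (0 : ℝ) 1 ∧ ‖x‖⁻¹ • x ∈ A} := by
  ext x
  constructor
  · rintro ⟨r, hr, a, ha, rfl⟩
    have h1 : ‖a‖ = 1 := by simpa using hA ha
    simp only [mem_ofPred_eq, norm_smul, h1, mul_one, Real.norm_eq_abs, abs_of_pos hr.1]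
    exact ⟨hr, by rwa [smul_smul, inv_mul_cancel₀ hr.1.ne', one_smul]⟩
  · rintro ⟨hx, ha⟩
    exact ⟨‖x‖, hx, _, ha, by simp only [smul_smul, mul_inv_cancel₀ hx.1.ne', one_smul]⟩

theorem lintegral_unitInterval (f : ℝ → ENNReal) :
    ∫⁻ x : I, f x = ∫⁻ x in Ioo (0 : ℝ) 1, f x := by
  rw [unitInterval.volume_def, lintegral_subtype_comap measurableSet_Icc f,
    Measure.restrict_congr_set Ioo_ae_eq_Icc]

theorem map_Phi_apply {B : Set S2} (hB : MeasurableSet B) :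
    Measure.map Phi volume B = ∫⁻ x in Ioo (0 : ℝ) 1, ∫⁻ y in Ioo (0 : ℝ) 1,
      ((↑) '' B : Set (EuclideanSpace ℝ (Fin 3))).indicator 1 (sphereParam x y) := by
  set A : Set (EuclideanSpace ℝ (Fin 3)) := (↑) '' B
  rw [Measure.map_apply continuous_Phi.measurable hB,
    ← lintegral_indicator_one (continuous_Phi.measurable hB), Measure.volume_eq_prod,
    lintegral_prod _ ((measurable_one.indicator
      (continuous_Phi.measurable hB)).aemeasurable), ← lintegral_unitInterval]
  refine lintegral_congr fun x => ?_
  rw [← lintegral_unitInterval]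
  refine lintegral_congr fun y => ?_
  have : sphereParam x y ∈ A ↔ Phi (x, y) ∈ B := by
    rw [← coe_Phi (x, y)]
    exact Subtype.val_injective.mem_set_image
  by_cases h : Phi (x, y) ∈ B
  · simp [h, this.2 h]
  · simp [h, mt this.1 h]

theorem cone_indicator (A : Set (EuclideanSpace ℝ (Fin 3))) (hAs : A ⊆ Metric.sphere 0 1)
    (x : ℝ) {r : ℝ} (hr : r ∈ Ioi (0 : ℝ)) {y : ℝ} (hy : y ∈ Ioo (0 : ℝ) 1) :
    (Ioo (0 : ℝ) 1 • A).indicator (1 : EuclideanSpace ℝ (Fin 3) → ENNReal)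
      (r • sphereParam x y) = (Iio (1 : ℝ)).indicator 1 r * A.indicator 1 (sphereParam x y) := by
  have hr' : (0 : ℝ) < r := hr
  have h1 := norm_sphereParam x (Ioo_subset_Icc_self hy)
  have hmem : r • sphereParam x y ∈ Ioo (0 : ℝ) 1 • A ↔ r < 1 ∧ sphereParam x y ∈ A := by
    rw [cone_eq A hAs]
    simp only [mem_ofPred_eq, norm_smul, h1, mul_one, Real.norm_eq_abs,
      abs_of_pos hr', smul_smul, inv_mul_cancel₀ hr'.ne', one_smul, mem_Ioo, hr', true_and]
  by_cases h2 : r < 1 <;> by_cases h3 : sphereParam x y ∈ A <;>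
    simp [indicator, hmem, h2, h3]

theorem lintegral_separated {s t u : Set ℝ} (hs : MeasurableSet s) (ht : MeasurableSet t)
    (hu : MeasurableSet u) {F : ℝ → ℝ → ℝ → ENNReal} {c : ℝ → ENNReal} {g : ℝ → ℝ → ENNReal}
    (hc : Measurable c) (hg : Measurable fun p : ℝ × ℝ => g p.1 p.2)
    (h : ∀ x ∈ s, ∀ r ∈ t, ∀ y ∈ u, F x r y = c r * g x y) :
    ∫⁻ x in s, ∫⁻ r in t, ∫⁻ y in u, F x r y =
      (∫⁻ r in t, c r) * ∫⁻ x in s, ∫⁻ y in u, g x y := by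
  have hi : Measurable fun x => ∫⁻ y in u, g x y :=
    hg.lintegral_prod_right' (ν := volume.restrict u)
  rw [← lintegral_const_mul _ hi]
  refine setLIntegral_congr_fun hs fun x hx => ?_
  rw [← lintegral_mul_const _ hc]
  refine setLIntegral_congr_fun ht fun r hr => ?_
  have hgx : Measurable fun y => g x y := hg.comp measurable_prodMk_left
  rw [← lintegral_const_mul _ hgx]
  exact setLIntegral_congr_fun hu fun y hy => h x hx r hr y hy

theorem volume_cone (A : Set (EuclideanSpace ℝ (Fin 3))) (hAs : A ⊆ Metric.sphere 0 1)
    (hA : MeasurableSet A) :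
    volume (Ioo (0 : ℝ) 1 • A) = ENNReal.ofReal (2 * Real.pi) *
      ((∫⁻ r in Ioi (0 : ℝ), ENNReal.ofReal (2 * r ^ 2) * (Iio (1 : ℝ)).indicator 1 r) *
      ∫⁻ x in Ioo (0 : ℝ) 1, ∫⁻ y in Ioo (0 : ℝ) 1, A.indicator 1 (sphereParam x y)) := by
  have hT : MeasurableSet (Ioo (0 : ℝ) 1 • A) := by
    rw [cone_eq A hAs]
    exact (measurable_norm measurableSet_Ioo).inter
      ((measurable_norm.inv.smul measurable_id) hA)
  have hind : Measurable fun p : ℝ × ℝ =>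
      A.indicator (1 : EuclideanSpace ℝ (Fin 3) → ENNReal) (sphereParam p.1 p.2) :=
    (measurable_one.indicator hA).comp continuous_sphereParam.measurable
  rw [← lintegral_indicator_one hT, lintegral_sphereParam _ (measurable_one.indicator hT)]
  refine congrArg (ENNReal.ofReal (2 * Real.pi) * ·) ?_
  have hr : Measurable fun r : ℝ => ENNReal.ofReal (2 * r ^ 2) *
      (Iio (1 : ℝ)).indicator (1 : ℝ → ENNReal) r :=
    Measurable.mul (by fun_prop) (measurable_one.indicator measurableSet_Iio)
  refine lintegral_separated measurableSet_Ioo measurableSet_Ioi measurableSet_Ioo hr hind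
    fun x _ r hr y hy => ?_
  rw [cone_indicator A hAs x hr hy, mul_assoc]

theorem toSphere_eq_const_mul : ∃ k : ENNReal, ∀ B : Set S2, MeasurableSet B →
    (volume : Measure (EuclideanSpace ℝ (Fin 3))).toSphere B = k * Measure.map Phi volume B := by
  refine ⟨3 * (ENNReal.ofReal (2 * Real.pi) *
    ∫⁻ r in Ioi (0 : ℝ), ENNReal.ofReal (2 * r ^ 2) * (Iio (1 : ℝ)).indicator 1 r),
    fun B hB => ?_⟩
  have hAs : ((↑) '' B : Set (EuclideanSpace ℝ (Fin 3))) ⊆ Metric.sphere 0 1 := by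
    rintro _ ⟨p, -, rfl⟩
    exact p.2
  have hA : MeasurableSet ((↑) '' B : Set (EuclideanSpace ℝ (Fin 3))) :=
    (MeasurableEmbedding.subtype_coe Metric.isClosed_sphere.measurableSet).measurableSet_image.2 hB
  rw [Measure.toSphere_apply' _ hB, finrank_euclideanSpace_fin, volume_cone _ hAs hA,
    map_Phi_apply hB, mul_assoc, mul_assoc, Nat.cast_ofNat]

instance : IsProbabilityMeasure (Measure.map Phi volume) :=
  Measure.isProbabilityMeasure_map continuous_Phi.measurable.aemeasurable

/-- The lifting map `Phi` carries Lebesgue measure to the normalized surface measure. -/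
theorem map_Phi_volume : Measure.map Phi volume = sigma2 := by
  obtain ⟨k, hk⟩ := toSphere_eq_const_mul
  have hu := hk univ .univ
  rw [measure_univ (μ := Measure.map Phi volume), mul_one] at hu
  have h0 : k ≠ 0 := by
    rw [← hu, Ne, Measure.measure_univ_eq_zero]
    exact Measure.toSphere_ne_zero _
  have ht : k ≠ ⊤ := hu ▸ measure_ne_top _ _
  ext B hB
  rw [sigma2, Measure.smul_apply, hu, hk B hB, smul_eq_mul, ← mul_assoc,
    ENNReal.inv_mul_cancel h0 ht, one_mul]

instance : IsProbabilityMeasure sigma2 := map_Phi_volume ▸ inferInstance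

theorem integral_sigma2_eq (f : S2 → ℝ) (hf : Measurable f) :
    ∫ w, f w ∂sigma2 = ∫ p : I × I, f (Phi p) := by
  rw [← map_Phi_volume, integral_map continuous_Phi.measurable.aemeasurable
    hf.aestronglyMeasurable]

/-! ### Rotation invariance -/

/-- The isometry of the sphere induced by a linear isometry of the ambient space. -/
def sphereMap (L : EuclideanSpace ℝ (Fin 3) ≃ₗᵢ[ℝ] EuclideanSpace ℝ (Fin 3)) (w : S2) : S2 :=
  ⟨L w, by simp⟩

theorem measurePreserving_sphereMap
    (L : EuclideanSpace ℝ (Fin 3) ≃ₗᵢ[ℝ] EuclideanSpace ℝ (Fin 3)) :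
    MeasurePreserving (sphereMap L) sigma2 sigma2 := by
  have hm : Measurable (sphereMap L) :=
    ((L.continuous.comp continuous_subtype_val).subtype_mk _).measurable
  refine ⟨hm, ?_⟩
  ext B hB
  rw [Measure.map_apply hm hB, sigma2, Measure.smul_apply, Measure.smul_apply,
    Measure.toSphere_apply' _ hB, Measure.toSphere_apply' _ (hm hB)]
  congr 2
  have : Ioo (0 : ℝ) 1 • ((↑) '' (sphereMap L ⁻¹' B) : Set (EuclideanSpace ℝ (Fin 3))) =
      L ⁻¹' (Ioo (0 : ℝ) 1 • ((↑) '' B)) := by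
    ext x
    constructor
    · rintro ⟨r, hr, _, ⟨w, hw, rfl⟩, rfl⟩
      exact ⟨r, hr, L w, ⟨sphereMap L w, hw, rfl⟩, by simp⟩
    · rintro ⟨r, hr, _, ⟨w, hw, rfl⟩, h⟩
      refine ⟨r, hr, L.symm w, ⟨sphereMap L.symm w, ?_, rfl⟩, ?_⟩
      · simpa [sphereMap] using hw
      · apply L.injective
        simpa using h
  rw [this, L.measurePreserving.measure_preimage_emb L.toHomeomorph.measurableEmbedding]

theorem exists_isometry_map {v w : EuclideanSpace ℝ (Fin 3)} (h : ‖v‖ = ‖w‖) :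
    ∃ L : EuclideanSpace ℝ (Fin 3) ≃ₗᵢ[ℝ] EuclideanSpace ℝ (Fin 3), L v = w :=
  ⟨_, Submodule.reflection_sub h⟩

/-- Archimedes: a linear coordinate is uniformly distributed on the sphere. -/
theorem integral_inner_sigma2 (x : S2) (f : ℝ → ℝ) (hf : Measurable f) :
    ∫ w, f (inner ℝ (x : EuclideanSpace ℝ (Fin 3)) w) ∂sigma2 = (∫ s in (-1 : ℝ)..1, f s) / 2 := by
  set e : EuclideanSpace ℝ (Fin 3) := EuclideanSpace.single 2 1
  obtain ⟨L, hL⟩ := exists_isometry_map (v := e) (w := x) (by simp [e])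
  have hmeas : ∀ v : EuclideanSpace ℝ (Fin 3), Measurable fun w : S2 => f (inner ℝ v w) :=
    fun v => hf.comp (by fun_prop)
  have h1 : ∫ w, f (inner ℝ (x : EuclideanSpace ℝ (Fin 3)) w) ∂sigma2 =
      ∫ w : S2, f (inner ℝ e w) ∂sigma2 := by
    have hmp := measurePreserving_sphereMap L
    rw [← hmp.map_eq, integral_map hmp.measurable.aemeasurable
      (hmeas _).aestronglyMeasurable, hmp.map_eq]
    refine integral_congr_ae (.of_forall fun w => ?_)
    simp only [sphereMap, ← hL, LinearIsometryEquiv.inner_map_map]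
  have h2 : ∀ p : I × I, inner ℝ e (Phi p : EuclideanSpace ℝ (Fin 3)) = 1 - 2 * (p.2 : ℝ) := by
    intro p
    simp [e, EuclideanSpace.inner_single_left, coe_Phi, sphereParam]
  rw [h1, integral_sigma2_eq _ (hmeas e)]
  simp only [h2]
  rw [Measure.volume_eq_prod, integral_fun_snd (fun y : I => f (1 - 2 * (y : ℝ))),
    probReal_univ, unitInterval.volume_def,
    integral_subtype_comap measurableSet_Icc (fun y => f (1 - 2 * y)),
    integral_Icc_eq_integral_Ioc, ← intervalIntegral.integral_of_le zero_le_one,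
    intervalIntegral.integral_comp_sub_mul (fun y => f y) two_ne_zero]
  norm_num
  ring

/-! ### Integrals over the sphere -/

theorem inner_mem_Icc (x w : S2) :
    inner ℝ (x : EuclideanSpace ℝ (Fin 3)) w ∈ Icc (-1 : ℝ) 1 := by
  have h := abs_real_inner_le_norm (x : EuclideanSpace ℝ (Fin 3)) w
  rw [norm_eq_of_mem_sphere x, norm_eq_of_mem_sphere w, one_mul] at h
  exact abs_le.1 h

theorem measurable_inner_right (x : S2) :
    Measurable fun w : S2 => inner ℝ (x : EuclideanSpace ℝ (Fin 3)) w :=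
  Continuous.measurable (by fun_prop)

/-- The indicator of `⟨x, w⟩ ≤ t`. -/
def capIndicator (x : S2) (t : ℝ) (w : S2) : ℝ :=
  (Iic t).indicator 1 (inner ℝ (x : EuclideanSpace ℝ (Fin 3)) w)

theorem capIndicator_eq_Ici (x : S2) (t : ℝ) (w : S2) : capIndicator x t w =
    (Ici (inner ℝ (x : EuclideanSpace ℝ (Fin 3)) w)).indicator 1 t := by
  simp [capIndicator, indicator_apply]

theorem capIndicator_mem_Icc (x : S2) (t : ℝ) (w : S2) : capIndicator x t w ∈ Icc (0 : ℝ) 1 := by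
  simp only [capIndicator, indicator_apply]
  split_ifs <;> simp

theorem measurable_capIndicator_uncurry (x : S2) :
    Measurable fun p : ℝ × S2 => capIndicator x p.1 p.2 := by
  have : (fun p : ℝ × S2 => capIndicator x p.1 p.2) =
      {p : ℝ × S2 | inner ℝ (x : EuclideanSpace ℝ (Fin 3)) p.2 ≤ p.1}.indicator 1 := by
    ext p
    simp [capIndicator, indicator]
  rw [this]
  exact measurable_one.indicator
    (measurableSet_le ((measurable_inner_right x).comp measurable_snd) measurable_fst)

theorem measurable_capIndicator (x : S2) (t : ℝ) : Measurable (capIndicator x t) :=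
  (measurable_capIndicator_uncurry x).comp measurable_prodMk_left

theorem integrable_capIndicator (x : S2) (t : ℝ) : Integrable (capIndicator x t) sigma2 :=
  Integrable.of_mem_Icc 0 1 (measurable_capIndicator x t).aemeasurable
    (.of_forall fun w => capIndicator_mem_Icc x t w)

theorem capIndicator_mul_mem_Icc (x y : S2) (t : ℝ) (w : S2) :
    capIndicator x t w * capIndicator y t w ∈ Icc (0 : ℝ) 1 :=
  ⟨mul_nonneg (capIndicator_mem_Icc x t w).1 (capIndicator_mem_Icc y t w).1,
    mul_le_one₀ (capIndicator_mem_Icc x t w).2 (capIndicator_mem_Icc y t w).1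
      (capIndicator_mem_Icc y t w).2⟩

theorem integrable_capIndicator_mul (x y : S2) (t : ℝ) :
    Integrable (fun w => capIndicator x t w * capIndicator y t w) sigma2 :=
  Integrable.of_mem_Icc 0 1
    ((measurable_capIndicator x t).mul (measurable_capIndicator y t)).aemeasurable
    (.of_forall fun w => capIndicator_mul_mem_Icc x y t w)

theorem integral_indicator_Iic {t : ℝ} (ht : t ∈ Icc (-1 : ℝ) 1) :
    ∫ s in (-1 : ℝ)..1, (Iic t).indicator (1 : ℝ → ℝ) s = 1 + t := by
  rw [intervalIntegral.integral_of_le (by norm_num), integral_indicator_one measurableSet_Iic,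
    measureReal_restrict_apply measurableSet_Iic,
    show Iic t ∩ Ioc (-1 : ℝ) 1 = Ioc (-1) t by ext s; simp; grind [ht.2],
    Real.volume_real_Ioc_of_le ht.1]
  ring

theorem integral_indicator_Ici {s : ℝ} (hs : s ∈ Icc (-1 : ℝ) 1) :
    ∫ t in (-1 : ℝ)..1, (Ici s).indicator (1 : ℝ → ℝ) t = 1 - s := by
  rw [intervalIntegral.integral_of_le (by norm_num), integral_indicator_one measurableSet_Ici,
    measureReal_congr Ioi_ae_eq_Ici.symm, measureReal_restrict_apply measurableSet_Ioi,
    show Ioi s ∩ Ioc (-1 : ℝ) 1 = Ioc s 1 by ext t; simp; grind [hs.1],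
    Real.volume_real_Ioc_of_le hs.2]

theorem integral_capIndicator (x : S2) {t : ℝ} (ht : t ∈ Icc (-1 : ℝ) 1) :
    ∫ w, capIndicator x t w ∂sigma2 = (1 + t) / 2 := by
  rw [← integral_indicator_Iic ht]
  exact integral_inner_sigma2 x _ (measurable_one.indicator measurableSet_Iic)

theorem sigma2_cap (w : S2) {t : ℝ} (ht : t ∈ Icc (-1 : ℝ) 1) :
    sigma2.real (cap w t) = (1 + t) / 2 := by
  have hm : MeasurableSet (cap w t) := by
    simp only [cap, real_inner_comm (w : EuclideanSpace ℝ (Fin 3))]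
    exact measurableSet_le (measurable_inner_right w) measurable_const
  rw [← integral_capIndicator w ht, ← integral_indicator_one hm]
  refine integral_congr_ae (.of_forall fun y => ?_)
  simp [capIndicator, cap, indicator, real_inner_comm]

theorem integral_norm_sub (x : S2) :
    ∫ w, ‖(x : EuclideanSpace ℝ (Fin 3)) - w‖ ∂sigma2 = 4 / 3 := by
  have h : ∀ w : S2, ‖(x : EuclideanSpace ℝ (Fin 3)) - w‖ =
      √(2 - 2 * inner ℝ (x : EuclideanSpace ℝ (Fin 3)) w) := by
    intro w
    rw [← Real.sqrt_sq (norm_nonneg _), norm_sub_sq_real, norm_eq_of_mem_sphere x,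
      norm_eq_of_mem_sphere w]
    congr 1
    ring
  simp only [h]
  rw [integral_inner_sigma2 x (fun s => √(2 - 2 * s)) (by fun_prop),
    intervalIntegral.integral_comp_sub_mul (fun u => √u) two_ne_zero]
  simp only [Real.sqrt_eq_rpow]
  rw [integral_rpow (by norm_num), show (2 : ℝ) - 2 * -1 = 2 ^ (2 : ℝ) by norm_num,
    ← Real.rpow_mul (by norm_num)]
  norm_num

theorem integral_abs_inner_unit (x : S2) :
    ∫ w : S2, |inner ℝ (x : EuclideanSpace ℝ (Fin 3)) w| ∂sigma2 = 1 / 2 := by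
  rw [integral_inner_sigma2 x (fun s => |s|) (by fun_prop)]
  have hi : ∀ a b : ℝ, IntervalIntegrable (fun s : ℝ => |s|) volume a b :=
    fun a b => continuous_abs.intervalIntegrable a b
  rw [← intervalIntegral.integral_add_adjacent_intervals (hi (-1) 0) (hi 0 1),
    intervalIntegral.integral_congr (g := fun s => -s) (a := -1),
    intervalIntegral.integral_congr (g := fun s => s) (a := 0)]
  · rw [intervalIntegral.integral_neg, integral_id, integral_id]
    norm_num
  · intro s hs
    rw [uIcc_of_le zero_le_one] at hs
    exact abs_of_nonneg hs.1
  · intro s hs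
    rw [uIcc_of_le (by norm_num)] at hs
    exact abs_of_nonpos hs.2

theorem integral_abs_inner (v : EuclideanSpace ℝ (Fin 3)) :
    ∫ w : S2, |inner ℝ v w| ∂sigma2 = ‖v‖ / 2 := by
  by_cases hv : v = 0
  · simp [hv]
  have hn : ‖v‖ ≠ 0 := norm_ne_zero_iff.2 hv
  set x : S2 := ⟨‖v‖⁻¹ • v, by simp [norm_smul, hn]⟩
  have h : ∀ w : S2, |inner ℝ v w| = ‖v‖ * |inner ℝ (x : EuclideanSpace ℝ (Fin 3)) w| := by
    intro w
    simp only [x, inner_smul_left, abs_mul]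
    simp [hn]
  simp only [h]
  rw [integral_const_mul, integral_abs_inner_unit]
  ring

theorem integral_inner_eq_zero (x : S2) :
    ∫ w : S2, inner ℝ (x : EuclideanSpace ℝ (Fin 3)) w ∂sigma2 = 0 := by
  rw [integral_inner_sigma2 x (fun s => s) measurable_id]
  simp

theorem integrable_of_continuous {E : Type*} [NormedAddCommGroup E] {f : S2 → E}
    (hf : Continuous f) : Integrable f sigma2 := by
  rw [← integrableOn_univ]
  exact hf.continuousOn.integrableOn_compact isCompact_univ

theorem integral_one_sub_max (x y : S2) :
    ∫ w : S2, (1 - max (inner ℝ (x : EuclideanSpace ℝ (Fin 3)) w)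
      (inner ℝ (y : EuclideanSpace ℝ (Fin 3)) w)) ∂sigma2 =
      1 - ‖(x : EuclideanSpace ℝ (Fin 3)) - y‖ / 4 := by
  have h : ∀ w : S2, 1 - max (inner ℝ (x : EuclideanSpace ℝ (Fin 3)) w)
      (inner ℝ (y : EuclideanSpace ℝ (Fin 3)) w) =
      (1 - (1 / 2) * inner ℝ (x : EuclideanSpace ℝ (Fin 3)) w -
        (1 / 2) * inner ℝ (y : EuclideanSpace ℝ (Fin 3)) w) -
        (1 / 2) * |inner ℝ ((x : EuclideanSpace ℝ (Fin 3)) - y) (w : EuclideanSpace ℝ (Fin 3))| := by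
    intro w
    rw [inner_sub_left]
    rcases le_total (inner ℝ (x : EuclideanSpace ℝ (Fin 3)) w)
      (inner ℝ (y : EuclideanSpace ℝ (Fin 3)) w) with h | h
    · rw [max_eq_right h, abs_of_nonpos (sub_nonpos.2 h)]; ring
    · rw [max_eq_left h, abs_of_nonneg (sub_nonneg.2 h)]; ring
  simp only [h]
  rw [integral_sub, integral_sub, integral_sub, integral_const_mul, integral_const_mul,
    integral_const_mul, integral_inner_eq_zero, integral_inner_eq_zero, integral_abs_inner]
  · simp; ring
  all_goals exact integrable_of_continuous (by fun_prop)

theorem integrable_capIndicator_mul_prod (x y : S2) :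
    Integrable (fun p : ℝ × S2 => capIndicator x p.1 p.2 * capIndicator y p.1 p.2)
      ((volume.restrict (Ioc (-1 : ℝ) 1)).prod sigma2) :=
  Integrable.of_mem_Icc 0 1 ((measurable_capIndicator_uncurry x).mul
    (measurable_capIndicator_uncurry y)).aemeasurable
    (.of_forall fun p => capIndicator_mul_mem_Icc x y p.1 p.2)

theorem intervalIntegrable_integral_capIndicator_mul (x y : S2) :
    IntervalIntegrable (fun t => ∫ w, capIndicator x t w * capIndicator y t w ∂sigma2)
      volume (-1) 1 := by
  rw [intervalIntegrable_iff_integrableOn_Ioc_of_le (by norm_num)]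
  exact (integrable_capIndicator_mul_prod x y).integral_prod_left

theorem integral_integral_capIndicator_mul (x y : S2) :
    ∫ t in (-1 : ℝ)..1, ∫ w, capIndicator x t w * capIndicator y t w ∂sigma2 =
      1 - ‖(x : EuclideanSpace ℝ (Fin 3)) - y‖ / 4 := by
  rw [intervalIntegral.integral_of_le (by norm_num),
    integral_integral_swap (integrable_capIndicator_mul_prod x y), ← integral_one_sub_max]
  refine integral_congr_ae (.of_forall fun w => ?_)
  simp only
  rw [← integral_indicator_Ici, intervalIntegral.integral_of_le (by norm_num)]
  · refine integral_congr_ae (.of_forall fun t => ?_)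
    simp only [capIndicator_eq_Ici, ← Ici_inter_Ici, inter_indicator_one, Pi.mul_apply]
  · exact ⟨le_max_of_le_left (inner_mem_Icc x w).1,
      max_le (inner_mem_Icc x w).2 (inner_mem_Icc y w).2⟩

/-! ### The cap discrepancy as an energy -/

theorem card_cap_eq_sum {N : ℕ} (z : Fin N → S2) (w : S2) (t : ℝ) :
    (Nat.card {k // z k ∈ cap w t} : ℝ) = ∑ k, capIndicator (z k) t w := by
  classical
  rw [Nat.card_eq_fintype_card, Fintype.card_subtype, Finset.card_filter]
  push_cast
  refine Finset.sum_congr rfl fun k _ => ?_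
  by_cases h : inner ℝ (z k : EuclideanSpace ℝ (Fin 3)) (w : EuclideanSpace ℝ (Fin 3)) ≤ t <;>
    simp [capIndicator, cap, h]

theorem integral_sq_local_discrepancy {N : ℕ} (hN : 0 < N) (z : Fin N → S2) {t : ℝ}
    (ht : t ∈ Icc (-1 : ℝ) 1) :
    ∫ w, |(Nat.card {k // z k ∈ cap w t} : ℝ) / N - sigma2.real (cap w t)| ^ 2 ∂sigma2 =
      1 / (N : ℝ) ^ 2 * ∑ i, ∑ j, ∫ w, capIndicator (z i) t w * capIndicator (z j) t w ∂sigma2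
        - ((1 + t) / 2) ^ 2 := by
  have hN' : (N : ℝ) ≠ 0 := by exact_mod_cast hN.ne'
  have h : ∀ w, |(Nat.card {k // z k ∈ cap w t} : ℝ) / N - sigma2.real (cap w t)| ^ 2 =
      1 / (N : ℝ) ^ 2 * ∑ i, ∑ j, capIndicator (z i) t w * capIndicator (z j) t w -
      (1 + t) / N * ∑ k, capIndicator (z k) t w + ((1 + t) / 2) ^ 2 := by
    intro w
    rw [sq_abs, sigma2_cap w ht, card_cap_eq_sum, ← Finset.sum_mul_sum]
    field_simp
    ring
  have i1 : ∀ i j, Integrable (fun w => capIndicator (z i) t w * capIndicator (z j) t w) sigma2 :=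
    fun i j => integrable_capIndicator_mul _ _ _
  have i2 : ∀ i, Integrable (fun w => ∑ j, capIndicator (z i) t w * capIndicator (z j) t w)
    sigma2 := fun i => integrable_finsetSum _ fun j _ => i1 i j
  have i3 : Integrable (fun w => ∑ i, ∑ j, capIndicator (z i) t w * capIndicator (z j) t w)
    sigma2 := integrable_finsetSum _ fun i _ => i2 i
  have i4 : Integrable (fun w => ∑ k, capIndicator (z k) t w) sigma2 :=
    integrable_finsetSum _ fun k _ => integrable_capIndicator _ _
  simp only [h]
  have i5 : Integrable (fun w => 1 / (N : ℝ) ^ 2 * ∑ i, ∑ j, capIndicator (z i) t w *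
      capIndicator (z j) t w - (1 + t) / N * ∑ k, capIndicator (z k) t w) sigma2 :=
    (i3.const_mul _).sub (i4.const_mul _)
  rw [integral_add i5 (integrable_const _),
    integral_sub (i3.const_mul _) (i4.const_mul _), integral_const_mul, integral_const_mul,
    integral_finsetSum _ fun i _ => i2 i,
    integral_finsetSum _ fun k _ => integrable_capIndicator _ _]
  simp only [integral_finsetSum _ fun j _ => i1 _ j, integral_capIndicator _ ht]
  simp
  field_simp
  ring

theorem sq_capL2Discrepancy {N : ℕ} (hN : 0 < N) (z : Fin N → S2) :
    capL2Discrepancy z ^ 2 = 1 / 3 - 1 / (4 * (N : ℝ) ^ 2) *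
      ∑ i, ∑ j, ‖(z i : EuclideanSpace ℝ (Fin 3)) - z j‖ := by
  have hN' : (N : ℝ) ≠ 0 := by exact_mod_cast hN.ne'
  rw [capL2Discrepancy, Real.sq_sqrt]
  · rw [intervalIntegral.integral_congr (g := fun t => 1 / (N : ℝ) ^ 2 * ∑ i, ∑ j,
      ∫ w, capIndicator (z i) t w * capIndicator (z j) t w ∂sigma2 - ((1 + t) / 2) ^ 2)]
    · have j1 : ∀ i j, IntervalIntegrable (fun t => ∫ w, capIndicator (z i) t w *
          capIndicator (z j) t w ∂sigma2) volume (-1) 1 :=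
        fun i j => intervalIntegrable_integral_capIndicator_mul _ _
      have j2 : ∀ i, IntervalIntegrable (fun t => ∑ j, ∫ w, capIndicator (z i) t w *
          capIndicator (z j) t w ∂sigma2) volume (-1) 1 :=
        fun i => by simpa only [Finset.sum_fn] using IntervalIntegrable.sum Finset.univ fun j _ => j1 i j
      have j3 : IntervalIntegrable (fun t => ∑ i, ∑ j, ∫ w, capIndicator (z i) t w *
          capIndicator (z j) t w ∂sigma2) volume (-1) 1 :=
        by simpa only [Finset.sum_fn] using IntervalIntegrable.sum Finset.univ fun i _ => j2 i
      rw [intervalIntegral.integral_sub (j3.const_mul _)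
        (Continuous.intervalIntegrable (by fun_prop) _ _), intervalIntegral.integral_const_mul,
        intervalIntegral.integral_finsetSum fun i _ => j2 i]
      simp only [intervalIntegral.integral_finsetSum fun j _ => j1 _ j,
        integral_integral_capIndicator_mul]
      have hq : ∫ t in (-1 : ℝ)..1, ((1 + t) / 2) ^ 2 = 2 / 3 := by
        rw [intervalIntegral.integral_comp_add_left (fun u : ℝ => (u / 2) ^ 2),
          intervalIntegral.integral_comp_div (fun u : ℝ => u ^ 2) two_ne_zero, integral_pow]
        norm_num
      rw [hq]
      simp only [Finset.sum_sub_distrib, Finset.sum_const, Finset.card_univ, Fintype.card_fin,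
        nsmul_eq_mul, ← Finset.sum_div]
      field_simp
      ring
    · intro t ht
      rw [uIcc_of_le (by norm_num)] at ht
      exact integral_sq_local_discrepancy hN z ht
  · exact intervalIntegral.integral_nonneg (by norm_num) fun t _ =>
      integral_nonneg fun w => by positivity

/-! ### The worst-case error as an energy -/

/-- The function `K(·, x)` as an element of `H^{3/2}`. -/
def kernelAt (x : S2) : H32 := RKHS.kerFun H32 x 1

theorem inner_kernelAt_left (x : S2) (f : H32) : inner ℝ (kernelAt x) f = f x := by
  rw [kernelAt, RKHS.kerFun_inner]
  simp

theorem kernelAt_apply (x y : S2) :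
    kernelAt y x = 8 / 3 - ‖(x : EuclideanSpace ℝ (Fin 3)) - y‖ := by
  rw [kernelAt, RKHS.kerFun_apply, RKHS.OfKernel.kernel_ofKernel]
  simp [distKernel]

theorem inner_kernelAt (x y : S2) : inner ℝ (kernelAt x) (kernelAt y) =
    8 / 3 - ‖(x : EuclideanSpace ℝ (Fin 3)) - y‖ := by
  rw [inner_kernelAt_left, kernelAt_apply]

theorem continuous_kernelAt : Continuous kernelAt := by
  have h : ∀ x y, dist (kernelAt x) (kernelAt y) =
      √(2 * ‖(x : EuclideanSpace ℝ (Fin 3)) - y‖) := by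
    intro x y
    rw [dist_eq_norm, ← Real.sqrt_sq (norm_nonneg _), norm_sub_sq_real,
      ← real_inner_self_eq_norm_sq, ← real_inner_self_eq_norm_sq, inner_kernelAt,
      inner_kernelAt, inner_kernelAt]
    congr 1
    simp
    ring
  rw [continuous_iff_continuousAt]
  intro x
  rw [ContinuousAt, tendsto_iff_dist_tendsto_zero]
  simp only [h]
  have hc : Continuous fun y : S2 => √(2 * ‖(y : EuclideanSpace ℝ (Fin 3)) - x‖) := by fun_prop
  simpa using hc.tendsto x

theorem integrable_kernelAt : Integrable kernelAt sigma2 :=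
  integrable_of_continuous continuous_kernelAt

/-- The Riesz representer of integration over the sphere. -/
def meanElement : H32 := ∫ x, kernelAt x ∂sigma2

theorem inner_meanElement (f : H32) : inner ℝ f meanElement = ∫ w, f w ∂sigma2 := by
  rw [meanElement, ← integral_inner integrable_kernelAt]
  refine integral_congr_ae (.of_forall fun w => ?_)
  simp only
  rw [real_inner_comm, inner_kernelAt_left]

theorem inner_kernelAt_meanElement (x : S2) : inner ℝ (kernelAt x) meanElement = 4 / 3 := by
  have h : ∀ w, kernelAt x w = 8 / 3 - ‖(x : EuclideanSpace ℝ (Fin 3)) - w‖ := fun w => by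
    rw [kernelAt_apply, norm_sub_rev]
  rw [inner_meanElement]
  simp only [h]
  rw [integral_sub (integrable_const _) (integrable_of_continuous (by fun_prop)),
    integral_norm_sub]
  simp
  norm_num

theorem inner_meanElement_self : inner ℝ meanElement meanElement = (4 / 3 : ℝ) := by
  rw [inner_meanElement]
  simp only [← inner_kernelAt_left, inner_kernelAt_meanElement]
  simp

/-- The Riesz representer of the quadrature error. -/
def errorElement {N : ℕ} (z : Fin N → S2) : H32 :=
  (1 / (N : ℝ)) • ∑ k, kernelAt (z k) - meanElement

theorem inner_errorElement {N : ℕ} (z : Fin N → S2) (f : H32) :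
    inner ℝ f (errorElement z) = quadrature z f - ∫ w, f w ∂sigma2 := by
  rw [errorElement, inner_sub_right, inner_meanElement, real_inner_smul_right, inner_sum,
    quadrature]
  congr 3
  ext k
  rw [real_inner_comm, inner_kernelAt_left]

theorem norm_errorElement_sq {N : ℕ} (hN : 0 < N) (z : Fin N → S2) :
    ‖errorElement z‖ ^ 2 = 4 / 3 - 1 / (N : ℝ) ^ 2 *
      ∑ i, ∑ j, ‖(z i : EuclideanSpace ℝ (Fin 3)) - z j‖ := by
  have hN' : (N : ℝ) ≠ 0 := by exact_mod_cast hN.ne'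
  rw [errorElement, norm_sub_sq_real, ← real_inner_self_eq_norm_sq, ← real_inner_self_eq_norm_sq,
    inner_meanElement_self, real_inner_smul_left, real_inner_smul_left, real_inner_smul_right,
    sum_inner, sum_inner]
  simp only [inner_sum, inner_kernelAt, inner_kernelAt_meanElement, Finset.sum_sub_distrib,
    Finset.sum_const, Finset.card_univ, Fintype.card_fin, nsmul_eq_mul]
  field_simp
  ring

theorem worstCaseError_eq_norm {N : ℕ} (z : Fin N → S2) :
    worstCaseError z = ‖errorElement z‖ := by
  set g := errorElement z
  have hset : {r : ℝ | ∃ f : H32, ‖f‖ ≤ 1 ∧ r = |quadrature z f - ∫ w, f w ∂sigma2|} =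
      {r : ℝ | ∃ f : H32, ‖f‖ ≤ 1 ∧ r = |inner ℝ f g|} := by
    simp only [g, inner_errorElement]
  rw [worstCaseError, hset]
  refine IsGreatest.csSup_eq ⟨?_, ?_⟩
  · by_cases hg : g = 0
    · exact ⟨0, by simp, by simp [hg]⟩
    · have hn : ‖g‖ ≠ 0 := norm_ne_zero_iff.2 hg
      refine ⟨‖g‖⁻¹ • g, by simp [norm_smul, hn], ?_⟩
      rw [real_inner_smul_left, real_inner_self_eq_norm_sq, abs_of_nonneg (by positivity)]
      field_simp
  · rintro r ⟨f, hf, rfl⟩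
    calc |inner ℝ f g| ≤ ‖f‖ * ‖g‖ := abs_real_inner_le_norm f g
      _ ≤ 1 * ‖g‖ := by gcongr
      _ = ‖g‖ := one_mul _

/-- Stolarsky's invariance principle for the kernel `8/3 - ‖y - z‖`. -/
theorem sq_worstCaseError_eq {N : ℕ} (hN : 0 < N) (z : Fin N → S2) :
    worstCaseError z ^ 2 = 4 * capL2Discrepancy z ^ 2 := by
  rw [worstCaseError_eq_norm, norm_errorElement_sq hN, sq_capL2Discrepancy hN]
  ring

/-! ### Counting grid cells that meet the boundary of a piecewise monotone region -/

/-- The `i`-th of the `n` intervals of equal length in `[0, 1)`. -/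
def gridCell (n i : ℕ) : Set ℝ := Ico ((i : ℝ) / n) (((i : ℝ) + 1) / n)

theorem left_mem_gridCell {n i : ℕ} (hi : i < n) : (i : ℝ) / n ∈ gridCell n i := by
  have hn : (0 : ℝ) < n := by exact_mod_cast (by omega : 0 < n)
  exact ⟨le_rfl, by gcongr; linarith⟩

theorem gridCell_subset {n i : ℕ} (hi : i < n) : gridCell n i ⊆ Ico 0 1 := by
  have hn : (0 : ℝ) < n := by exact_mod_cast (by omega : 0 < n)
  have hi' : (i : ℝ) + 1 ≤ n := by exact_mod_cast hi
  refine fun x hx => ⟨le_trans (by positivity) hx.1, lt_of_lt_of_le hx.2 ?_⟩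
  rwa [div_le_one hn]

theorem lt_of_mem_gridCell {n i j : ℕ} (hij : i < j) {x y : ℝ} (hx : x ∈ gridCell n i)
    (hy : y ∈ gridCell n j) : x < y := by
  have hij' : (i : ℝ) + 1 ≤ j := by exact_mod_cast hij
  exact (hx.2.trans_le (by gcongr)).trans_le hy.1

theorem disjoint_gridCell {n i j : ℕ} (hij : i ≠ j) : Disjoint (gridCell n i) (gridCell n j) := by
  rw [Set.disjoint_left]
  intro x hx hy
  rcases lt_or_gt_of_ne hij with h | h
  · exact lt_irrefl x (lt_of_mem_gridCell h hx hy)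
  · exact lt_irrefl x (lt_of_mem_gridCell h hy hx)

/-- The intervals on which the label `k` is not constant. -/
def mixedCells (n : ℕ) (k : ℝ → ℤ) : Set (Fin n) :=
  {i | ∃ x ∈ gridCell n i, k x ≠ k ((i : ℝ) / n)}

open Classical in
theorem card_mixedCells_le {n : ℕ} {k : ℝ → ℤ} (hk : MonotoneOn k (Ico 0 1)) {P : Finset ℤ}
    (hP : ∀ x ∈ Ico (0 : ℝ) 1, k x ∈ P) : (mixedCells n k).toFinset.card ≤ P.card := by
  have hlt : ∀ i j : Fin n, i ∈ mixedCells n k → i < j → k ((i : ℝ) / n) < k ((j : ℝ) / n) := by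
    rintro i j ⟨x, hx, hne⟩ hij
    have hi := left_mem_gridCell i.2
    have hj := left_mem_gridCell j.2
    have h1 := hk (gridCell_subset i.2 hi) (gridCell_subset i.2 hx) hx.1
    have h2 := hk (gridCell_subset i.2 hx) (gridCell_subset j.2 hj)
      (lt_of_mem_gridCell hij hx hj).le
    exact (lt_of_le_of_ne h1 hne.symm).trans_le h2
  refine Finset.card_le_card_of_injOn (fun i => k ((i : ℝ) / n))
    (fun i _ => hP _ (gridCell_subset i.2 (left_mem_gridCell i.2))) ?_
  intro i hi j hj h
  simp only [Finset.mem_coe, Set.mem_toFinset] at hi hj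
  rcases lt_trichotomy i j with hij | hij | hij
  · exact absurd h (hlt i j hi hij).ne
  · exact hij
  · exact absurd h (hlt j i hj hij).ne'

/-- The cells of the `K × M` grid that contain points of `A` and of its complement. -/
def crossingCells (K M : ℕ) (A : ℝ → ℝ → Prop) : Set (Fin K × Fin M) :=
  {c | (∃ x ∈ gridCell K c.1, ∃ y ∈ gridCell M c.2, A x y) ∧
    ∃ x ∈ gridCell K c.1, ∃ y ∈ gridCell M c.2, ¬ A x y}

open Classical in
/-- If the labels `k` and `l` cut `[0, 1)` into intervals such that `A` is monotone in each variable
on each product of pieces, then only `O(K + M)` cells of the grid cross the boundary of `A`. -/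
theorem card_crossingCells_le {K M : ℕ} {A : ℝ → ℝ → Prop} {k l : ℝ → ℤ}
    (hk : MonotoneOn k (Ico 0 1)) (hl : MonotoneOn l (Ico 0 1)) {P Q : Finset ℤ}
    (hP : ∀ x ∈ Ico (0 : ℝ) 1, k x ∈ P) (hQ : ∀ x ∈ Ico (0 : ℝ) 1, l x ∈ Q)
    (up vp : ℤ → Prop)
    (hA : ∀ x ∈ Ico (0 : ℝ) 1, ∀ x' ∈ Ico (0 : ℝ) 1, ∀ y ∈ Ico (0 : ℝ) 1, ∀ y' ∈ Ico (0 : ℝ) 1,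
      k x = k x' → l y = l y' → (up (k x) ∧ x ≤ x' ∨ ¬ up (k x) ∧ x' ≤ x) →
      (vp (l y) ∧ y ≤ y' ∨ ¬ vp (l y) ∧ y' ≤ y) → A x y → A x' y') :
    (crossingCells K M A).toFinset.card ≤
      P.card * M + K * Q.card + P.card * (Q.card * (K + M)) := by
  set S := (crossingCells K M A).toFinset
  set U := (mixedCells K k).toFinset
  set V := (mixedCells M l).toFinset
  set T := S.filter fun c => c.1 ∉ U ∧ c.2 ∉ V
  have hsub : S ⊆ (U ×ˢ Finset.univ ∪ Finset.univ ×ˢ V) ∪ T := by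
    intro c hc
    by_cases h1 : c.1 ∈ U
    · simp [h1]
    · by_cases h2 : c.2 ∈ V
      · simp [h2]
      · simp [T, hc, h1, h2]
  have hT : T.card ≤ P.card * (Q.card * (K + M)) := by
    rw [← Finset.card_range (K + M), ← Finset.card_product, ← Finset.card_product]
    have hTmem : ∀ c, c ∈ T ↔ c ∈ crossingCells K M A ∧ c.1 ∉ mixedCells K k ∧
        c.2 ∉ mixedCells M l := fun c => by simp [T, S, U, V]
    have key : ∀ c ∈ T, ∀ c' ∈ T, k ((c.1 : ℕ) / (K : ℝ)) = k ((c'.1 : ℕ) / (K : ℝ)) →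
        l ((c.2 : ℕ) / (M : ℝ)) = l ((c'.2 : ℕ) / (M : ℝ)) →
        ¬ ((up (k ((c.1 : ℕ) / (K : ℝ))) ∧ c.1 < c'.1 ∨
          ¬ up (k ((c.1 : ℕ) / (K : ℝ))) ∧ c'.1 < c.1) ∧
        (vp (l ((c.2 : ℕ) / (M : ℝ))) ∧ c.2 < c'.2 ∨
          ¬ vp (l ((c.2 : ℕ) / (M : ℝ))) ∧ c'.2 < c.2)) := by
      rintro c hc c' hc' hkk hll ⟨h1, h2⟩
      rw [hTmem] at hc hc'
      obtain ⟨⟨⟨x, hx, y, hy, hxy⟩, -⟩, hcU, hcV⟩ := hc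
      obtain ⟨⟨-, x', hx', y', hy', hxy'⟩, hcU', hcV'⟩ := hc'
      have ex : k x = _ := by_contra fun h => hcU ⟨x, hx, h⟩
      have ey : l y = _ := by_contra fun h => hcV ⟨y, hy, h⟩
      have ex' : k x' = _ := by_contra fun h => hcU' ⟨x', hx', h⟩
      have ey' : l y' = _ := by_contra fun h => hcV' ⟨y', hy', h⟩
      refine hxy' (hA x (gridCell_subset c.1.2 hx) x' (gridCell_subset c'.1.2 hx')
        y (gridCell_subset c.2.2 hy) y' (gridCell_subset c'.2.2 hy')
        (by rw [ex, ex', hkk]) (by rw [ey, ey', hll]) ?_ ?_ hxy)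
      · rw [ex]
        exact h1.imp (fun h => ⟨h.1, (lt_of_mem_gridCell h.2 hx hx').le⟩)
          fun h => ⟨h.1, (lt_of_mem_gridCell h.2 hx' hx).le⟩
      · rw [ey]
        exact h2.imp (fun h => ⟨h.1, (lt_of_mem_gridCell h.2 hy hy').le⟩)
          fun h => ⟨h.1, (lt_of_mem_gridCell h.2 hy' hy).le⟩
    refine Finset.card_le_card_of_injOn (fun c => (k ((c.1 : ℕ) / (K : ℝ)),
      l ((c.2 : ℕ) / (M : ℝ)), if (up (k ((c.1 : ℕ) / (K : ℝ))) ↔ vp (l ((c.2 : ℕ) / (M : ℝ))))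
        then (c.1 : ℕ) + (M - 1 - c.2) else (c.1 : ℕ) + c.2)) ?_ ?_
    · intro c _
      simp only [Finset.mem_coe, Finset.mem_product, Finset.mem_range]
      refine ⟨hP _ (gridCell_subset c.1.2 (left_mem_gridCell c.1.2)),
        hQ _ (gridCell_subset c.2.2 (left_mem_gridCell c.2.2)), ?_⟩
      split_ifs <;> omega
    · intro c hc c' hc' h
      simp only [Prod.mk.injEq] at h
      obtain ⟨hkk, hll, hd⟩ := h
      have k1 := key c hc c' hc' hkk hll
      have k2 := key c' hc' c hc hkk.symm hll.symm
      rw [← hkk, ← hll] at hd k2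
      have e1 := c.2.2
      have e2 := c'.2.2
      simp only [Fin.lt_def] at k1 k2
      by_cases hs : up (k ((c.1 : ℕ) / (K : ℝ))) <;> by_cases ht : vp (l ((c.2 : ℕ) / (M : ℝ))) <;>
        simp only [hs, ht, if_true, if_false, true_and, false_and, not_true, not_false_iff,
          or_false, false_or, iff_self, iff_true, iff_false] at hd k1 k2 <;>
        exact Prod.ext (Fin.ext (by omega)) (Fin.ext (by omega))
  calc S.card ≤ ((U ×ˢ Finset.univ ∪ Finset.univ ×ˢ V) ∪ T).card := Finset.card_le_card hsub
    _ ≤ (U ×ˢ (Finset.univ : Finset (Fin M))).card +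
        ((Finset.univ : Finset (Fin K)) ×ˢ V).card + T.card :=
      (Finset.card_union_le _ _).trans (by gcongr; exact Finset.card_union_le _ _)
    _ ≤ _ := by
      rw [Finset.card_product, Finset.card_product, Finset.card_univ, Finset.card_univ,
        Fintype.card_fin, Fintype.card_fin]
      gcongr
      · exact card_mixedCells_le hk hP
      · exact card_mixedCells_le hl hQ

/-! ### Comparing two probability measures through a partition -/

theorem abs_sub_le_card_div {X ι : Type*} [MeasurableSpace X] [Fintype ι] [Nonempty ι]
    (μ ν : Measure X) [IsProbabilityMeasure μ] [IsProbabilityMeasure ν] {R : ι → Set X}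
    (hR : ∀ c, MeasurableSet (R c)) (hd : Pairwise fun c d => Disjoint (R c) (R d))
    (hμ : ∀ c, μ.real (R c) = 1 / Fintype.card ι) (hν : ∀ c, ν.real (R c) = 1 / Fintype.card ι)
    {B : Set X} (hB : MeasurableSet B) (S : Finset ι)
    (hS : ∀ c ∉ S, R c ⊆ B ∨ R c ⊆ Bᶜ) :
    |μ.real B - ν.real B| ≤ S.card / Fintype.card ι := by
  classical
  set n : ℝ := (Fintype.card ι : ℝ)
  have hn : 0 < n := Nat.cast_pos.2 Fintype.card_pos
  set J := Sᶜ.filter fun c => R c ⊆ B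
  set O := Sᶜ.filter fun c => ¬ R c ⊆ B
  have hcard : (S.card : ℝ) + (J.card + O.card) = n := by
    have h1 : J.card + O.card = Sᶜ.card := Finset.card_filter_add_card_filter_not _
    have h2 := Finset.card_add_card_compl S
    rw [← h1] at h2
    simp only [n, ← h2, Nat.cast_add]
  have main : ∀ ρ : Measure X, IsProbabilityMeasure ρ → (∀ c, ρ.real (R c) = 1 / n) →
      J.card / n ≤ ρ.real B ∧ ρ.real B ≤ 1 - O.card / n := by
    intro ρ hρ hc
    have hsum : ∀ F : Finset ι, ρ.real (⋃ c ∈ F, R c) = F.card / n := by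
      intro F
      rw [measureReal_biUnion_finset (fun c _ d _ hcd => hd hcd) fun c _ => hR c]
      simp [hc, div_eq_mul_inv]
    constructor
    · rw [← hsum]
      exact measureReal_mono (iUnion₂_subset fun c hc => (Finset.mem_filter.1 hc).2)
    · have : (O.card : ℝ) / n ≤ ρ.real Bᶜ := by
        rw [← hsum]
        refine measureReal_mono (iUnion₂_subset fun c hc => ?_)
        have hc := Finset.mem_filter.1 hc
        exact (hS c (Finset.mem_compl.1 hc.1)).resolve_left hc.2
      rw [probReal_compl_eq_one_sub hB] at this
      linarith
  have h1 := main μ inferInstance hμ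
  have h2 := main ν inferInstance hν
  have h3 : (S.card : ℝ) / n = 1 - O.card / n - J.card / n := by
    field_simp
    linarith
  rw [abs_le, h3]
  constructor <;> linarith

/-! ### The shape of lifted caps -/

theorem cap_ratio_mono {a c s s' : ℝ} (hs : 0 < s) (hss : s ≤ s') (h : a ≤ c * s ^ 2)
    (h' : a ≤ c * s' ^ 2) : a / s + c * s ≤ a / s' + c * s' := by
  have hs' : 0 < s' := hs.trans_le hss
  have key : a ≤ c * (s * s') := by
    rcases le_total 0 c with hc | hc
    · exact h.trans (by rw [sq]; gcongr)
    · refine h'.trans (mul_le_mul_of_nonpos_left ?_ hc)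
      rw [sq]
      gcongr
  have : a / s' + c * s' - (a / s + c * s) = (s' - s) * (c * (s * s') - a) / (s * s') := by
    field_simp
    ring
  have : 0 ≤ (s' - s) * (c * (s * s') - a) / (s * s') :=
    div_nonneg (mul_nonneg (sub_nonneg.2 hss) (sub_nonneg.2 key)) (by positivity)
  linarith

/-- For `0 < y < 1` the lift of `(x, y)` lies in the cap with parameters `w`, `t` when the
trigonometric polynomial of `x` is at most `capHeight ((t - w 2) / 2) ((t + w 2) / 2) y`. -/
def capHeight (a c y : ℝ) : ℝ := a / √(y / (1 - y)) + c * √(y / (1 - y))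

theorem capHeight_mono {a c y y' : ℝ} (hy : 0 < y) (hyy : y ≤ y') (hy' : y' < 1)
    (h : a ≤ (a + c) * y) (h' : a ≤ (a + c) * y') : capHeight a c y ≤ capHeight a c y' := by
  have h1 : 0 < 1 - y := by linarith
  have h1' : 0 < 1 - y' := by linarith
  have hq : 0 < y / (1 - y) := div_pos hy h1
  have hq' : 0 < y' / (1 - y') := div_pos (hy.trans_le hyy) h1'
  refine cap_ratio_mono (Real.sqrt_pos.2 hq) (Real.sqrt_le_sqrt ?_) ?_ ?_
  · rw [div_le_div_iff₀ h1 h1']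
    nlinarith
  · rw [Real.sq_sqrt hq.le, ← mul_div_assoc, le_div_iff₀ h1]
    linarith
  · rw [Real.sq_sqrt hq'.le, ← mul_div_assoc, le_div_iff₀ h1']
    linarith

theorem capHeight_anti {a c y y' : ℝ} (hy : 0 < y) (hyy : y ≤ y') (hy' : y' < 1)
    (h : (a + c) * y ≤ a) (h' : (a + c) * y' ≤ a) : capHeight a c y' ≤ capHeight a c y := by
  have := capHeight_mono (a := -a) (c := -c) hy hyy hy' (by linarith) (by linarith)
  simp only [capHeight, neg_div, neg_mul] at this ⊢
  linarith

/-- The preimage of a cap in the parameter square. -/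
def liftedCap (w : S2) (t x y : ℝ) : Prop :=
  inner ℝ (sphereParam x y) (w : EuclideanSpace ℝ (Fin 3)) ≤ t

/-- The restriction of the linear functional `w` to the circle of latitude, before scaling. -/
def trigPart (w : S2) (x : ℝ) : ℝ :=
  (w : EuclideanSpace ℝ (Fin 3)) 0 * Real.cos (2 * Real.pi * x) +
    (w : EuclideanSpace ℝ (Fin 3)) 1 * Real.sin (2 * Real.pi * x)

theorem inner_sphereParam (w : S2) (x y : ℝ) :
    inner ℝ (sphereParam x y) (w : EuclideanSpace ℝ (Fin 3)) =
      2 * √(y - y ^ 2) * trigPart w x + (w : EuclideanSpace ℝ (Fin 3)) 2 * (1 - 2 * y) := by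
  rw [PiLp.inner_apply, Fin.sum_univ_three]
  simp [sphereParam, trigPart]
  ring

theorem liftedCap_iff (w : S2) (t x : ℝ) {y : ℝ} (hy : y ∈ Ioo (0 : ℝ) 1) :
    liftedCap w t x y ↔ trigPart w x ≤ capHeight ((t - (w : EuclideanSpace ℝ (Fin 3)) 2) / 2)
      ((t + (w : EuclideanSpace ℝ (Fin 3)) 2) / 2) y := by
  have h1 : 0 < 1 - y := by linarith [hy.2]
  have hp : 0 < √y := Real.sqrt_pos.2 hy.1
  have hq : 0 < √(1 - y) := Real.sqrt_pos.2 h1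
  have hp2 := Real.sq_sqrt hy.1.le
  have hq2 := Real.sq_sqrt h1.le
  rw [liftedCap, inner_sphereParam, capHeight, Real.sqrt_div hy.1.le,
    show y - y ^ 2 = y * (1 - y) by ring, Real.sqrt_mul hy.1.le]
  set p := √y
  set q := √(1 - y)
  set u := trigPart w x
  set v := (w : EuclideanSpace ℝ (Fin 3)) 2
  have e : (t - v) / 2 / (p / q) + (t + v) / 2 * (p / q) =
      ((t - v) / 2 * q ^ 2 + (t + v) / 2 * p ^ 2) / (p * q) := by
    field_simp
  rw [e, le_div_iff₀ (by positivity), hp2, hq2]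
  constructor <;> intro h <;> linarith

theorem exists_trigPart_eq (w : S2) : ∃ ρ φ : ℝ, 0 ≤ ρ ∧ φ ∈ Ioc (-Real.pi) Real.pi ∧
    ∀ x, trigPart w x = ρ * Real.cos (2 * Real.pi * x - φ) := by
  set z : ℂ := ⟨(w : EuclideanSpace ℝ (Fin 3)) 0, (w : EuclideanSpace ℝ (Fin 3)) 1⟩
  refine ⟨‖z‖, z.arg, norm_nonneg _, ⟨Complex.neg_pi_lt_arg z, Complex.arg_le_pi z⟩, fun x => ?_⟩
  have h1 : ‖z‖ * Real.cos z.arg = (w : EuclideanSpace ℝ (Fin 3)) 0 := Complex.norm_mul_cos_arg z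
  have h2 : ‖z‖ * Real.sin z.arg = (w : EuclideanSpace ℝ (Fin 3)) 1 := Complex.norm_mul_sin_arg z
  rw [trigPart, Real.cos_sub, ← h1, ← h2]
  ring

theorem cos_le_of_even_floor {p : ℤ} (hp : Even p) {x x' : ℝ}
    (h : p * Real.pi ≤ x) (hxx : x ≤ x') (h' : x' ≤ (p + 1) * Real.pi) :
    Real.cos x' ≤ Real.cos x := by
  have := Real.strictAntiOn_cos.antitoneOn (a := x - p * Real.pi) (b := x' - p * Real.pi)
    ⟨by linarith, by linarith⟩ ⟨by linarith, by linarith⟩ (by linarith)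
  simpa only [Real.cos_sub_int_mul_pi, hp.neg_one_zpow, one_mul] using this

theorem cos_le_of_odd_floor {p : ℤ} (hp : ¬ Even p) {x x' : ℝ}
    (h : p * Real.pi ≤ x) (hxx : x ≤ x') (h' : x' ≤ (p + 1) * Real.pi) :
    Real.cos x ≤ Real.cos x' := by
  have := Real.strictAntiOn_cos.antitoneOn (a := x - p * Real.pi) (b := x' - p * Real.pi)
    ⟨by linarith, by linarith⟩ ⟨by linarith, by linarith⟩ (by linarith)
  simp only [Real.cos_sub_int_mul_pi, (Int.not_even_iff_odd.1 hp).neg_one_zpow] at this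
  linarith

/-- The label of the monotone pieces in the latitude variable. -/
def latitudeLabel (a t y : ℝ) : ℤ :=
  if y ≤ 0 then -2 else if a ≤ t * y then (if 0 ≤ t then 1 else -1) else 0

theorem latitudeLabel_mono (a t : ℝ) : Monotone (latitudeLabel a t) := by
  intro y y' hyy
  simp only [latitudeLabel]
  rcases le_or_gt 0 t with ht | ht
  · have : t * y ≤ t * y' := by gcongr
    split_ifs <;> first | (exfalso; linarith) | norm_num
  · have : t * y' ≤ t * y := mul_le_mul_of_nonpos_left hyy ht.le
    split_ifs <;> first | (exfalso; linarith) | norm_num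

theorem latitudeLabel_mem (a t y : ℝ) : latitudeLabel a t y ∈ Finset.Icc (-2 : ℤ) 1 := by
  simp only [latitudeLabel]
  split_ifs <;> decide

open Classical in
theorem card_crossingCells_liftedCap_le (K M : ℕ) (w : S2) (t : ℝ) :
    (crossingCells K M (liftedCap w t)).toFinset.card ≤ 20 * (K + M) := by
  obtain ⟨ρ, φ, hρ, hφ, htrig⟩ := exists_trigPart_eq w
  have hpi := Real.pi_pos
  set v := (w : EuclideanSpace ℝ (Fin 3)) 2
  set a := (t - v) / 2
  have hac : a + (t + v) / 2 = t := by simp only [a]; ring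
  set k : ℝ → ℤ := fun x => ⌊(2 * Real.pi * x - φ) / Real.pi⌋
  have hk : Monotone k := fun x y hxy => Int.floor_mono (by gcongr)
  have hP : ∀ x ∈ Ico (0 : ℝ) 1, k x ∈ Finset.Icc (-1 : ℤ) 2 := by
    intro x hx
    rw [Finset.mem_Icc]
    constructor
    · rw [Int.le_floor, le_div_iff₀ hpi]
      push_cast
      nlinarith [hx.1, hφ.2]
    · refine Int.lt_add_one_iff.1 ?_
      rw [Int.floor_lt, div_lt_iff₀ hpi]
      push_cast
      nlinarith [hx.2, hφ.1]
  have hfloor : ∀ x, k x * Real.pi ≤ 2 * Real.pi * x - φ ∧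
      2 * Real.pi * x - φ ≤ (k x + 1) * Real.pi := fun x =>
    ⟨(le_div_iff₀ hpi).1 (Int.floor_le _), (div_le_iff₀ hpi).1 (Int.lt_floor_add_one _).le⟩
  have hmain := card_crossingCells_le (K := K) (M := M) (A := liftedCap w t)
    (hk.monotoneOn _) ((latitudeLabel_mono a t).monotoneOn _) hP
    (fun y _ => latitudeLabel_mem a t y) (fun p => Even p) (fun q => q ≠ 0) ?_
  · refine hmain.trans ?_
    have c1 : (Finset.Icc (-1 : ℤ) 2).card = 4 := rfl
    have c2 : (Finset.Icc (-2 : ℤ) 1).card = 4 := rfl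
    rw [c1, c2]
    omega
  intro x _ x' _ y hy y' hy' hkk hll hx hyd hA
  rcases hy.1.eq_or_lt with rfl | hy0
  · have hy0' : y' = 0 := by
      by_contra hne
      have : 0 < y' := lt_of_le_of_ne hy'.1 (Ne.symm hne)
      simp only [latitudeLabel, le_refl, if_true, not_le.2 this, if_false] at hll
      split_ifs at hll <;> omega
    subst hy0'
    simpa [liftedCap, inner_sphereParam] using hA
  have hy0' : 0 < y' := by
    by_contra hne
    simp only [latitudeLabel, not_le.2 hy0, not_lt.1 hne, if_false, if_true] at hll
    split_ifs at hll <;> omega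
  rw [liftedCap_iff w t x ⟨hy0, hy.2⟩] at hA
  rw [liftedCap_iff w t x' ⟨hy0', hy'.2⟩]
  refine (?_ : trigPart w x' ≤ trigPart w x).trans (hA.trans ?_)
  · rw [htrig, htrig]
    refine mul_le_mul_of_nonneg_left ?_ hρ
    have f1 := hfloor x
    have f2 := hfloor x'
    rw [← hkk] at f2
    rcases hx with ⟨he, hxx⟩ | ⟨ho, hxx⟩
    · exact cos_le_of_even_floor he f1.1 (by gcongr) f2.2
    · exact cos_le_of_odd_floor ho f2.1 (by gcongr) f1.2
  · have hcond : ∀ {s : ℝ}, 0 < s → (latitudeLabel a t s ≠ 0 ↔ a ≤ t * s) := by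
      intro s hs
      simp only [latitudeLabel, not_le.2 hs, if_false]
      split_ifs <;> simp [*]
    rcases hyd with ⟨hm, hyy⟩ | ⟨hm, hyy⟩
    · exact capHeight_mono hy0 hyy hy'.2 (by rw [hac]; exact (hcond hy0).1 hm)
        (by rw [hac]; exact (hcond hy0').1 (hll ▸ hm))
    · refine capHeight_anti hy0' hyy hy.2 ?_ ?_
      · rw [hac]
        exact (not_le.1 (mt (hcond hy0').2 (hll ▸ hm))).le
      · rw [hac]
        exact (not_le.1 (mt (hcond hy0).2 hm)).le

/-! ### Local discrepancy of nets -/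

/-- The elementary cell of the parameter square with index `c`. -/
def squareCell (K M : ℕ) (c : Fin K × Fin M) : Set (I × I) :=
  ((↑) ⁻¹' gridCell K c.1) ×ˢ ((↑) ⁻¹' gridCell M c.2)

theorem measurableSet_squareCell (K M : ℕ) (c : Fin K × Fin M) :
    MeasurableSet (squareCell K M c) :=
  (measurable_subtype_coe measurableSet_Ico).prod (measurable_subtype_coe measurableSet_Ico)

theorem volume_coe_preimage_gridCell {n i : ℕ} (hi : i < n) :
    (volume : Measure I).real ((↑) ⁻¹' gridCell n i) = 1 / n := by
  have hn : (0 : ℝ) < n := by exact_mod_cast (by omega : 0 < n)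
  have hm : MeasurableSet (gridCell n i) := measurableSet_Ico
  rw [unitInterval.measurePreserving_coe.measureReal_preimage hm.nullMeasurableSet,
    measureReal_restrict_apply hm,
    inter_eq_left.2 ((gridCell_subset hi).trans Ico_subset_Icc_self), gridCell,
    Real.volume_real_Ico_of_le (by gcongr; linarith)]
  field_simp
  ring

theorem volume_squareCell (K M : ℕ) (c : Fin K × Fin M) :
    (volume : Measure (I × I)).real (squareCell K M c) = 1 / (K * M) := by
  rw [squareCell, Measure.volume_eq_prod, measureReal_prod_prod,
    volume_coe_preimage_gridCell c.1.2, volume_coe_preimage_gridCell c.2.2]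
  field_simp

theorem disjoint_squareCell (K M : ℕ) :
    Pairwise fun c d : Fin K × Fin M => Disjoint (squareCell K M c) (squareCell K M d) := by
  intro c d hcd
  rw [squareCell, squareCell, Set.disjoint_prod]
  by_cases h : c.1 = d.1
  · exact Or.inr ((disjoint_gridCell fun h2 => hcd (Prod.ext h (Fin.ext h2))).preimage _)
  · exact Or.inl ((disjoint_gridCell fun h2 => h (Fin.ext h2)).preimage _)

/-- The empirical measure of a point set. -/
def empirical {X : Type*} [MeasurableSpace X] {N : ℕ} (P : Fin N → X) : Measure X :=
  (N : ENNReal)⁻¹ • Measure.map P Measure.count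

theorem empirical_real {X : Type*} [MeasurableSpace X] {N : ℕ} (P : Fin N → X) {B : Set X}
    (hB : MeasurableSet B) : (empirical P).real B = (Nat.card {n // P n ∈ B} : ℝ) / N := by
  classical
  rw [empirical, measureReal_ennreal_smul_apply, map_measureReal_apply measurable_from_top hB,
    Measure.real, Measure.count_apply (measurable_from_top hB), ENNReal.toReal_inv,
    ENNReal.toReal_natCast, div_eq_inv_mul]
  congr 1
  rw [Set.encard_eq_coe_toFinset_card]
  simp [Nat.card_eq_fintype_card, Fintype.card_subtype]

theorem isProbabilityMeasure_empirical {X : Type*} [MeasurableSpace X] {N : ℕ} (hN : 0 < N)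
    (P : Fin N → X) : IsProbabilityMeasure (empirical P) := by
  refine ⟨?_⟩
  rw [empirical, Measure.smul_apply, Measure.map_apply measurable_from_top .univ]
  simp only [preimage_univ, Measure.count_univ, smul_eq_mul]
  simp
  exact ENNReal.inv_mul_cancel (by exact_mod_cast hN.ne') (by simp)

theorem abs_local_discrepancy_le {K M : ℕ} (hK : 0 < K) (hM : 0 < M) {N : ℕ} (hN : N = K * M)
    (P : Fin N → I × I) (hP : ∀ c, ∃! n, P n ∈ squareCell K M c) (w : S2) (t : ℝ) :
    |(Nat.card {n // Phi (P n) ∈ cap w t} : ℝ) / N - sigma2.real (cap w t)| ≤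
      20 * (K + M) / N := by
  classical
  have hcap : MeasurableSet (cap w t) :=
    measurableSet_le (Continuous.measurable (by fun_prop)) measurable_const
  have hB : MeasurableSet (Phi ⁻¹' cap w t) := continuous_Phi.measurable hcap
  have hσ : sigma2.real (cap w t) = (volume : Measure (I × I)).real (Phi ⁻¹' cap w t) := by
    rw [← map_Phi_volume, map_measureReal_apply continuous_Phi.measurable hcap]
  have := isProbabilityMeasure_empirical (hN ▸ Nat.mul_pos hK hM) P
  have : Nonempty (Fin K × Fin M) := ⟨⟨0, hK⟩, ⟨0, hM⟩⟩
  have hcard : (Fintype.card (Fin K × Fin M) : ℝ) = K * M := by simp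
  have hNr : (N : ℝ) = K * M := by simp [hN]
  have h := abs_sub_le_card_div (empirical P) (volume : Measure (I × I))
    (measurableSet_squareCell K M) (disjoint_squareCell K M)
    (fun c => by
      have hu : Nat.card {n // P n ∈ squareCell K M c} = 1 := by
        obtain ⟨n, hn, hu⟩ := hP c
        have : Unique {n // P n ∈ squareCell K M c} :=
          ⟨⟨⟨n, hn⟩⟩, fun m => Subtype.ext (hu m m.2)⟩
        exact Nat.card_unique
      rw [empirical_real P (measurableSet_squareCell K M c), hu, hcard, hNr, Nat.cast_one])
    (fun c => by rw [volume_squareCell, hcard]) hB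
    (crossingCells K M (liftedCap w t)).toFinset
    (fun c hc => by
      rw [Set.mem_toFinset] at hc
      by_contra hcon
      rw [not_or, Set.not_subset, Set.not_subset] at hcon
      obtain ⟨⟨p, hp, hpB⟩, q, hq, hqB⟩ := hcon
      refine hc ⟨⟨q.1, hq.1, q.2, hq.2, ?_⟩, p.1, hp.1, p.2, hp.2, ?_⟩
      · exact not_notMem.1 hqB
      · exact hpB)
  rw [empirical_real P hB, ← hσ, hcard, ← hNr] at h
  refine h.trans ?_
  gcongr
  exact_mod_cast card_crossingCells_liftedCap_le K M w t

theorem sq_capL2Discrepancy_le {N : ℕ} (z : Fin N → S2) {δ : ℝ}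
    (h : ∀ w t, |(Nat.card {k // z k ∈ cap w t} : ℝ) / N - sigma2.real (cap w t)| ≤ δ) :
    capL2Discrepancy z ^ 2 ≤ 2 * δ ^ 2 := by
  have h0 : ∀ t, 0 ≤ ∫ w, |(Nat.card {k // z k ∈ cap w t} : ℝ) / N
      - sigma2.real (cap w t)| ^ 2 ∂sigma2 := fun t => integral_nonneg fun w => by positivity
  have h1 : ∀ t, ∫ w, |(Nat.card {k // z k ∈ cap w t} : ℝ) / N
      - sigma2.real (cap w t)| ^ 2 ∂sigma2 ≤ δ ^ 2 := by
    intro t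
    have := norm_integral_le_of_norm_le_const (μ := sigma2) (C := δ ^ 2)
      (f := fun w => |(Nat.card {k // z k ∈ cap w t} : ℝ) / N - sigma2.real (cap w t)| ^ 2)
      (.of_forall fun w => by
        rw [Real.norm_of_nonneg (by positivity)]
        gcongr
        exact h w t)
    rw [probReal_univ, mul_one] at this
    exact (le_abs_self _).trans this
  rw [capL2Discrepancy, Real.sq_sqrt (intervalIntegral.integral_nonneg (by norm_num)
    fun t _ => h0 t)]
  have := intervalIntegral.norm_integral_le_of_norm_le_const (a := (-1 : ℝ)) (b := 1)
    (C := δ ^ 2) (f := fun t => ∫ w, |(Nat.card {k // z k ∈ cap w t} : ℝ) / N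
      - sigma2.real (cap w t)| ^ 2 ∂sigma2)
    fun t _ => by rw [Real.norm_of_nonneg (h0 t)]; exact h1 t
  refine ((le_abs_self _).trans this).trans_eq ?_
  norm_num
  ring

/-- The lift of a `(0,m,2)`-net has squared spherical cap `L₂`-discrepancy `O(1 / N)`. -/
theorem sq_capL2Discrepancy_net_le {b : ℕ} (hb : 2 ≤ b) {m : ℕ} {P : Fin (b ^ m) → I × I}
    (hP : IsNet b m P) :
    capL2Discrepancy (fun n => Phi (P n)) ^ 2 ≤ 800 * (1 + b : ℝ) ^ 2 / (b : ℝ) ^ m := by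
  have hb0 : 0 < b := by omega
  set K := b ^ (m / 2)
  set M := b ^ (m - m / 2)
  have hKM : b ^ m = K * M := by
    rw [← pow_add]
    congr 1
    omega
  have hMK : M ≤ b * K := by
    rw [← pow_succ']
    exact Nat.pow_le_pow_right hb0 (by omega)
  have hKK : K ^ 2 ≤ b ^ m := by
    rw [← pow_mul]
    exact Nat.pow_le_pow_right hb0 (by omega)
  have hcells : ∀ c, ∃! n, P n ∈ squareCell K M c := by
    intro c
    have := hP.2 (m / 2) (m - m / 2) (by omega) c.1 c.1.2 c.2 c.2.2
    simpa only [squareCell, gridCell, mem_prod, mem_preimage, K, M, Nat.cast_pow] using this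
  have h := sq_capL2Discrepancy_le (fun n => Phi (P n)) fun w t =>
    abs_local_discrepancy_le (pow_pos hb0 _) (pow_pos hb0 _) hKM P hcells w t
  have hMK' : (M : ℝ) ≤ b * K := by exact_mod_cast hMK
  have hKK' : (K : ℝ) ^ 2 ≤ (b : ℝ) ^ m := by exact_mod_cast hKK
  have hN : (0 : ℝ) < (b : ℝ) ^ m := by positivity
  refine h.trans ?_
  rw [show ((b ^ m : ℕ) : ℝ) = (b : ℝ) ^ m from Nat.cast_pow b m, div_pow,
    ← mul_div_assoc, div_le_div_iff₀ (by positivity) hN]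
  calc 2 * (20 * ((K : ℝ) + M)) ^ 2 * (b : ℝ) ^ m
      ≤ 2 * (20 * ((K : ℝ) + b * K)) ^ 2 * (b : ℝ) ^ m := by gcongr
    _ = 800 * (1 + b : ℝ) ^ 2 * (K : ℝ) ^ 2 * (b : ℝ) ^ m := by ring
    _ ≤ 800 * (1 + b : ℝ) ^ 2 * (b : ℝ) ^ m * (b : ℝ) ^ m := by gcongr
    _ = 800 * (1 + b : ℝ) ^ 2 * ((b : ℝ) ^ m) ^ 2 := by ring

end SphereNets

end

theorem mainTheorem4 (b : ℕ) (hb : 2 ≤ b) :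
    ∃ C : ℝ, 0 < C ∧
      ∀ m : ℕ, 1 ≤ m →
      ∀ (R : Type*) [CommRing R] (η : Fin b ≃ R) (C₁ C₂ : Matrix (Fin m) (Fin m) R),
        SphereNets.IsNet b m (SphereNets.digitalPoints hb η C₁ C₂) →
        ∀ (N : ℕ) (Z : Fin (b ^ m) → SphereNets.S2), N = b ^ m →
          Z = (fun n => SphereNets.Phi (SphereNets.digitalPoints hb η C₁ C₂ n)) →
          SphereNets.worstCaseError Z ^ 2 ≤ C * ((N : ℝ)⁻¹ * Real.log N) ∧
          SphereNets.capL2Discrepancy Z ≤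
            C * ((N : ℝ) ^ (-(1 / 2) : ℝ) * Real.log N ^ (1 / 2 : ℝ)) ∧
          SphereNets.worstCaseError Z ^ 2 = 4 * SphereNets.capL2Discrepancy Z ^ 2 := by
  refine ⟨6400 * (1 + b : ℝ) ^ 2, by positivity, ?_⟩
  rintro m hm R _ η C₁ C₂ hnet N Z hN rfl
  have hD := SphereNets.sq_capL2Discrepancy_net_le hb hnet
  have hS := SphereNets.sq_worstCaseError_eq (Nat.pow_pos (by omega : 0 < b))
    fun n => SphereNets.Phi (SphereNets.digitalPoints hb η C₁ C₂ n)
  set D := SphereNets.capL2Discrepancy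
    fun n => SphereNets.Phi (SphereNets.digitalPoints hb η C₁ C₂ n)
  have hN2 : (2 : ℝ) ≤ N := by
    have : 2 ≤ b ^ m := hb.trans (Nat.le_self_pow (by omega) b)
    exact_mod_cast hN ▸ this
  have hNpos : (0 : ℝ) < N := by linarith
  have hlog : (1 / 2 : ℝ) ≤ Real.log N := by
    have := Real.log_le_log (by norm_num) hN2
    linarith [Real.log_two_gt_d9]
  have hq : (N : ℝ)⁻¹ ≤ 2 * ((N : ℝ)⁻¹ * Real.log N) := by
    have : 0 ≤ (N : ℝ)⁻¹ := by positivity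
    nlinarith
  have hDN : D ^ 2 ≤ 1600 * (1 + b : ℝ) ^ 2 * ((N : ℝ)⁻¹ * Real.log N) := by
    have hNb : (b : ℝ) ^ m = N := by rw [hN, Nat.cast_pow]
    rw [hNb, div_eq_mul_inv] at hD
    refine hD.trans ?_
    calc 800 * (1 + b : ℝ) ^ 2 * (N : ℝ)⁻¹
        ≤ 800 * (1 + b : ℝ) ^ 2 * (2 * ((N : ℝ)⁻¹ * Real.log N)) := by gcongr
      _ = _ := by ring
  refine ⟨?_, ?_, hS⟩
  · rw [hS]
    linarith
  · rw [Real.rpow_neg hNpos.le, ← Real.inv_rpow hNpos.le,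
      ← Real.mul_rpow (by positivity) (by linarith), ← Real.sqrt_eq_rpow]
    have hb1 : (1 : ℝ) ≤ 1 + b := by linarith [(Nat.cast_nonneg b : (0 : ℝ) ≤ b)]
    refine (Real.le_sqrt_of_sq_le hDN).trans ?_
    rw [Real.sqrt_mul (by positivity)]
    gcongr
    refine Real.sqrt_le_iff.2 ⟨by positivity, ?_⟩
    have h4 : (1 + b : ℝ) ^ 2 ≤ ((1 + b : ℝ) ^ 2) ^ 2 := by
      have : 1 ≤ (1 + b : ℝ) ^ 2 := one_le_pow₀ hb1
      nlinarith
    rw [mul_pow]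
    nlinarith [sq_nonneg (1 + b : ℝ)]
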